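/- Let $\mathsf P$ be a finite irreducible Markov kernel on a state space $V$ with $|V|\ge 2$ (entries in $[0,1]$, row sums one, and for all $x,y$ there is $t$ with $\mathsf P^t(x,y)>0$), with stationary distribution $\pi$. For $A,B\subseteq V$ write $\pi(A)=\sum_{x\in A}\pi(x)$, $\mathsf Q(A,B)=\sum_{x\in A,\,y\in B}\pi(x)\mathsf P(x,y)$, $A_u=\{v\in V:\mathsf Q(A,\{v\})\ge u\,\pi(v)\}$ and $$\Psi(A)=\frac12\int_0^1|\pi(A_u)-\pi(A)|\,du .$$ Let $\Psi_{min}=\min_{\emptyset\ne A\subsetneq V}\Psi(A)$, $\Delta_{min}=\min\{|\pi(A)-\pi(B)|: A,B\subseteq V,\ \pi(A)\ne\pi(B)\}$, $A_{max}=\max\{\Psi_{min},\Delta_{min}/2\}$ and $\pi_*=\min_{x\in V}\pi(x)$. For $\epsilon>0$ let $\tau(\epsilon)$, $\tau_D(\epsilon)$, $\tau_2(\epsilon)$ be the least $t\ge 0$ such that, for every $x\in V$, respectively $\|\mathsf P^t(x,\cdot)-\pi\|_{TV}\le\epsilon$, $\mathrm D(\mathsf P^t(x,\cdot)\,\|\,\pi)\le\epsilon$,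 $\|\mathsf P^t(x,\cdot)/\pi-1\|_{2,\pi}\le\epsilon$, where $\|\sigma-\pi\|_{TV}=\frac12\sum_x|\sigma(x)-\pi(x)|$, $\mathrm D(\sigma\|\pi)=\sum_x\sigma(x)\log\frac{\sigma(x)}{\pi(x)}$ and $\|\sigma/\pi-1\|_{2,\pi}=\big(\sum_x\pi(x)(\sigma(x)/\pi(x)-1)^2\big)^{1/2}$. For real $s$ let $\lceil s\rceil_+=\max\{0,\lceil s\rceil\}$. Then every complex eigenvalue $\lambda_i\neq 1$ of $\mathsf P$ satisfies $$1-|\lambda_i|\ \ge\ 16\,\Psi_{min}A_{max},$$ and, if $\Psi_{min}>0$, then for every $\epsilon>0$ these mixing times are finite and $$\tau(\epsilon)\le\begin{cases}\left\lceil\dfrac{\frac{1-4\pi_*^2}{2}+\log\frac1{2\epsilon}}{16\,\Psi_{min}A_{max}}\right\rceil_+ & \epsilon\le\frac12,\\[2ex] \left\lceil\dfrac{(1-\epsilon)^2-\pi_*^2}{8\,\Psi_{min}A_{max}}\right\rceil_+ & \epsilon>\frac12,\end{cases}$$ $$\tau_D(\epsilon)\le\begin{cases}\left\lceil\dfrac{1-e\,\pi_*^2+\log\frac1{2\epsilon}}{4e\,\Psi_{min}A_{max}}\right\rceil_+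 & \epsilon\le\frac12,\\[2ex] \left\lceil\dfrac{e^{-2\epsilon}-\pi_*^2}{4\,\Psi_{min}A_{max}}\right\rceil_+ & \epsilon>\frac12,\end{cases}$$ $$\tau_2(\epsilon)\le\begin{cases}\left\lceil\dfrac{\frac23+\log\frac1\epsilon}{8\,\Psi_{min}A_{max}}\right\rceil_+ & \epsilon\le1,\\[2ex] \left\lceil\dfrac{1+3\epsilon^2}{6\,\Psi_{min}A_{max}(1+\epsilon^2)^3}\right\rceil_+ & \epsilon>1.\end{cases}$$ -/

import Mathlib

namespace EvolvingSets

open Matrix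

noncomputable section

/-- A finite irreducible Markov kernel `P` on `V` with stationary distribution `π`. -/
structure IsMarkovChain {V : Type*} [Fintype V] [DecidableEq V]
    (P : Matrix V V ℝ) (π : V → ℝ) : Prop where
  nonneg : ∀ x y, 0 ≤ P x y
  row_sum : ∀ x, ∑ y, P x y = 1
  irreducible : ∀ x y, ∃ t : ℕ, 0 < (P ^ t) x y
  pi_nonneg : ∀ x, 0 ≤ π x
  pi_sum : ∑ x, π x = 1
  stationary : π ᵥ* P = π

/-- `π(A)`. -/
def mass {V : Type*} (π : V → ℝ) (A : Finset V) : ℝ := ∑ x ∈ A, π x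

/-- The ergodic flow `Q(A, B)`. -/
def flow {V : Type*} (P : Matrix V V ℝ) (π : V → ℝ) (A B : Finset V) : ℝ :=
  ∑ x ∈ A, ∑ y ∈ B, π x * P x y

/-- The level set `A_u = {v : Q(A, v) ≥ u π(v)}`. -/
def levelSet {V : Type*} [Fintype V] (P : Matrix V V ℝ) (π : V → ℝ)
    (A : Finset V) (u : ℝ) : Finset V :=
  {v : V | u * π v ≤ flow P π A {v}}

/-- The modified ergodic flow `Ψ(A)`. The integrand is a bounded step function of `u`. -/
def modFlow {V : Type*} [Fintype V] (P : Matrix V V ℝ) (π : V → ℝ) (A : Finset V) : ℝ :=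
  (1 / 2) * ∫ u in (0 : ℝ)..1, |mass π (levelSet P π A u) - mass π A|

/-- `Ψ_min`, the minimum of `Ψ(A)` over the nonempty proper subsets `A` of `V`. -/
def modFlowMin {V : Type*} [Fintype V] (P : Matrix V V ℝ) (π : V → ℝ) : ℝ :=
  ⨅ A : {A : Finset V // A.Nonempty ∧ A ≠ Finset.univ}, modFlow P π A.1

/-- `Δ_min`, the smallest nonzero difference `|π(A) - π(B)|`. -/
def gapMin {V : Type*} (π : V → ℝ) : ℝ :=
  ⨅ p : {p : Finset V × Finset V // mass π p.1 ≠ mass π p.2},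
    |mass π p.1.1 - mass π p.1.2|

/-- `A_max = max {Ψ_min, Δ_min / 2}`. -/
def aMax {V : Type*} [Fintype V] (P : Matrix V V ℝ) (π : V → ℝ) : ℝ :=
  max (modFlowMin P π) (gapMin π / 2)

/-- `π_* = min_x π(x)`. -/
def piStar {V : Type*} (π : V → ℝ) : ℝ := ⨅ x, π x

/-- Total variation distance. -/
def tvDist {V : Type*} [Fintype V] (σ π : V → ℝ) : ℝ := (1 / 2) * ∑ x, |σ x - π x|

/-- Relative entropy `D(σ ‖ π)`, with `0 log 0 = 0`. -/
def relEntropy {V : Type*} [Fintype V] (σ π : V → ℝ) : ℝ :=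
  ∑ x, π x * (σ x / π x) * Real.log (σ x / π x)

/-- The `L²` distance `‖σ/π - 1‖_{2,π}`. -/
def l2Dist {V : Type*} [Fintype V] (σ π : V → ℝ) : ℝ :=
  Real.sqrt (∑ x, π x * (σ x / π x - 1) ^ 2)

/-- The mixing time for the distance `d`: the least `t` such that `d(P^t(x, ·), π) ≤ ε` for every
starting state `x` (and `⊤` if there is no such `t`). -/
def mixingTime {V : Type*} [Fintype V] [DecidableEq V] (d : (V → ℝ) → (V → ℝ) → ℝ)
    (P : Matrix V V ℝ) (π : V → ℝ) (ε : ℝ) : ℕ∞ :=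
  ⨅ t : {t : ℕ // ∀ x, d ((P ^ t) x) π ≤ ε}, ((t : ℕ) : ℕ∞)

end

end EvolvingSets

/-! The engine is the evolving set process: from `A` move to `A_u` with `u` uniform on `[0,1]`. The
mass `π(A_u)` is a martingale, and its mean absolute deviation from `π(A)` is `2Ψ(A)`. Reweighting
each transition by `π(B)/π(A)` (Doob transform) gives a chain of nonempty sets `S_t` absorbed at
`V`, with `P^t(x,·)` equal to the average of `π` conditioned on `S_t` (`pow_apply_eq`). A set of
mass `a` has distance `G(a) = 1-a`, `-log a` or `√((1-a)/a)` from stationarity, so convexity bounds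
the true distance by `I_t = E G(π(S_t))`.

Put `κ = Ψ_min A_max`. A weighted Cauchy–Schwarz inequality (`four_mul_le_sum_sq_div`), applied to
the martingale increment, gives the conditional decay `E G(π(S_{t+1})) ≤ G - κ g(G)` at every
nonempty proper set, with an explicit `g` for each distance. Averaging this requires a convex rate
vanishing at `0`, since the absorbed state does not decay. So `g` is replaced below the minimiser
`b` of `g(y)/y` by the chord `c y`, `c = g(b)/b`. The recursion for `I_t` then compares with `I' =
-κ g(I)`, and integrating `1/g` yields the mixing times: a logarithm below `b`, the potential `F`
above it.

For eigenvalues, the linear part of the total variation rate gives decay like `(1-16κ)^t`. An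
eigenvector with eigenvalue `z ≠ 1` is annihilated by `π`, so `|z|^t` is at most a constant times
this. -/

namespace EvolvingSets

open Matrix

/-! ### Scalar inequalities behind the one-step decay. -/

section Analysis

/-- A weighted Cauchy–Schwarz bound for a centred random variable `X` which vanishes or has
absolute value at least `Δ`. -/
theorem four_mul_le_sum_sq_div {ι : Type*} [Fintype ι] {k X : ι → ℝ} {β ψ Δ : ℝ}
    (hk : ∀ i, 0 ≤ k i) (hk1 : ∑ i, k i = 1) (hX0 : ∑ i, k i * X i = 0)
    (hψ : ∑ i, k i * |X i| = 2 * ψ) (hΔ : ∀ i, X i ≠ 0 → Δ ≤ |X i|)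
    (hβ : ∀ i, 0 < 1 + β * X i) :
    4 * (ψ * max ψ (Δ / 2)) ≤ ∑ i, k i * (X i ^ 2 / (1 + β * X i)) := by
  classical
  set χ : ι → ℝ := fun i => if X i = 0 then 0 else 1 with hχ
  have hχ0 : ∀ i, 0 ≤ χ i := fun i => by simp only [hχ]; split_ifs <;> norm_num
  have hχ1 : ∀ i, χ i ≤ 1 := fun i => by simp only [hχ]; split_ifs <;> norm_num
  have hrhs : 0 ≤ ∑ i, k i * (X i ^ 2 / (1 + β * X i)) :=
    Finset.sum_nonneg fun i _ => mul_nonneg (hk i) (div_nonneg (sq_nonneg _) (hβ i).le)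
  have hψ0 : 0 ≤ ψ := by
    have : 0 ≤ ∑ i, k i * |X i| := Finset.sum_nonneg fun i _ => mul_nonneg (hk i) (abs_nonneg _)
    linarith
  -- `m` is the probability that `X ≠ 0`. Cauchy–Schwarz yields `4ψ²/m`; the bounds `m ≤ 1` and `mΔ
  -- ≤ 2ψ` turn this into the two alternatives of the maximum.
  obtain ⟨m, hm⟩ : ∃ m, m = ∑ i, k i * χ i := ⟨_, rfl⟩
  have hm0 : 0 ≤ m := hm ▸ Finset.sum_nonneg fun i _ => mul_nonneg (hk i) (hχ0 i)
  have hm1 : m ≤ 1 := by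
    rw [hm, ← hk1]
    exact Finset.sum_le_sum fun i _ => mul_le_of_le_one_right (hk i) (hχ1 i)
  have hmΔ : m * Δ ≤ 2 * ψ := by
    rw [hm, ← hψ, Finset.sum_mul]
    refine Finset.sum_le_sum fun i _ => ?_
    rw [mul_assoc]
    refine mul_le_mul_of_nonneg_left ?_ (hk i)
    by_cases h : X i = 0
    · simp [hχ, h]
    · simpa [hχ, h] using hΔ i h
  rcases hm0.eq_or_lt with h0 | hmpos
  · have hz : ∀ i, k i * χ i = 0 := by
      have := (Finset.sum_eq_zero_iff_of_nonneg
        (fun i (_ : i ∈ Finset.univ) => mul_nonneg (hk i) (hχ0 i))).1 (hm.symm.trans h0.symm)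
      exact fun i => this i (Finset.mem_univ i)
    have : ∑ i, k i * |X i| = 0 := by
      refine Finset.sum_eq_zero fun i _ => ?_
      by_cases h : X i = 0
      · simp [h]
      · have := hz i
        simp only [hχ, h, if_false, mul_one] at this
        simp [this]
    have hψz : ψ = 0 := by linarith
    simpa [hψz] using hrhs
  obtain ⟨c, hc⟩ : ∃ c, c = 2 * ψ / m := ⟨_, rfl⟩
  have hcm : c * m = 2 * ψ := by rw [hc]; field_simp
  have hc0 : 0 ≤ c := by rw [hc]; positivity
  -- Cauchy–Schwarz in tangent form: `(|X| - cL)² ≥ 0` with `L = 1 + βX` gives `X²/L ≥ 2c|X| - c²L`,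
  -- and `c = 2ψ/m` is the optimal multiplier. The term in `β` averages to zero because `X` is
  -- centred.
  have key : ∑ i, k i * (2 * c * |X i| - c ^ 2 * (χ i + β * X i)) ≤
      ∑ i, k i * (X i ^ 2 / (1 + β * X i)) := by
    refine Finset.sum_le_sum fun i _ => mul_le_mul_of_nonneg_left ?_ (hk i)
    by_cases h : X i = 0
    · simp [hχ, h]
    · simp only [hχ, h, if_false]
      rw [le_div_iff₀ (hβ i)]
      nlinarith [sq_nonneg (|X i| - c * (1 + β * X i)), sq_abs (X i)]
  have hsum : ∑ i, k i * (2 * c * |X i| - c ^ 2 * (χ i + β * X i)) = 2 * c * ψ := by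
    have : ∀ i, k i * (2 * c * |X i| - c ^ 2 * (χ i + β * X i)) =
        2 * c * (k i * |X i|) - c ^ 2 * (k i * χ i) - c ^ 2 * β * (k i * X i) := fun i => by ring
    simp only [this, Finset.sum_sub_distrib, ← Finset.mul_sum, hψ, hX0, ← hm]
    linear_combination (-c) * hcm
  rw [hsum] at key
  refine le_trans ?_ key
  have h1 : 2 * ψ ≤ c := by nlinarith
  have h2 : Δ ≤ c := by
    rw [hc, le_div_iff₀ hmpos]; linarith
  have h3 : max ψ (Δ / 2) ≤ c / 2 := max_le (by linarith) (by linarith)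
  nlinarith

/-- The difference of the two sides is `N`, with `N(1) = N'(1) = 0`. It is convex because `N'' = 1/v
- 27/(v+2)³ ≥ 0`, which is AM–GM in the form `(v+2)³ - 27v = (v-1)²(v+8)`. -/
theorem sq_div_le_mul_log {u : ℝ} (hu : 0 ≤ u) :
    (u - 1) ^ 2 / (2 * (1 + (u - 1) / 3)) ≤ u * Real.log u - (u - 1) := by
  rcases hu.eq_or_lt with rfl | hu
  · norm_num
  set D : ℝ → ℝ := fun u => Real.log u - 3 / 2 + 27 / 2 * ((u + 2) ^ 2)⁻¹ with hD
  set N : ℝ → ℝ := fun u =>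
    u * Real.log u - 5 / 2 * u + 7 - 27 / 2 * (u + 2)⁻¹ with hN
  have dD : ∀ v, 0 < v → HasDerivAt D (v⁻¹ - 27 / (v + 2) ^ 3) v := by
    intro v hv
    have hv2 : v + 2 ≠ 0 := by positivity
    have h2 : HasDerivAt (fun u : ℝ => (u + 2) ^ 2) (2 * (v + 2)) v := by
      simpa using ((hasDerivAt_id v).add_const (2 : ℝ)).fun_pow 2
    have := ((Real.hasDerivAt_log hv.ne').sub_const (3 / 2)).add
      ((h2.inv (pow_ne_zero 2 hv2)).const_mul (27 / 2))
    refine this.congr_deriv ?_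
    field_simp
    ring
  have dN : ∀ v, 0 < v → HasDerivAt N (D v) v := by
    intro v hv
    have hv2 : v + 2 ≠ 0 := by positivity
    have h2 : HasDerivAt (fun u : ℝ => u + 2) 1 v := (hasDerivAt_id v).add_const (2 : ℝ)
    have := ((((Real.hasDerivAt_mul_log hv.ne').sub
      ((hasDerivAt_id v).const_mul (5 / 2))).add_const 7)).sub
      ((h2.inv hv2).const_mul (27 / 2))
    refine this.congr_deriv ?_
    simp only [hD]
    field_simp
    ring
  have mD : MonotoneOn D (Set.Ioi 0) := by
    refine monotoneOn_of_deriv_nonneg (convex_Ioi 0)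
      (fun v hv => (dD v hv).continuousAt.continuousWithinAt)
      (fun v hv => (dD v (by simpa using hv)).differentiableAt.differentiableWithinAt) ?_
    intro v hv
    have hv : 0 < v := by simpa using hv
    rw [(dD v hv).deriv, sub_nonneg, div_le_iff₀ (by positivity), ← div_eq_inv_mul,
      le_div_iff₀ hv]
    nlinarith [mul_nonneg (sq_nonneg (v - 1)) (by linarith : 0 ≤ v + 8)]
  have D1 : D 1 = 0 := by simp [hD]; norm_num
  have N1 : N 1 = 0 := by simp [hN]; norm_num
  have hNu : 0 ≤ N u := by
    rcases le_total u 1 with h | h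
    · have : AntitoneOn N (Set.Ioc 0 1) := by
        refine antitoneOn_of_deriv_nonpos (convex_Ioc 0 1)
          (fun v hv => (dN v hv.1).continuousAt.continuousWithinAt)
          (fun v hv => (dN v (interior_subset hv).1).differentiableAt.differentiableWithinAt) ?_
        intro v hv
        have hv := interior_subset hv
        rw [(dN v hv.1).deriv, ← D1]
        exact mD hv.1 (by simp) hv.2
      have := this ⟨hu, h⟩ ⟨one_pos, le_rfl⟩ h
      linarith
    · have : MonotoneOn N (Set.Ici 1) := by
        refine monotoneOn_of_deriv_nonneg (convex_Ici 1)
          (fun v hv => (dN v (one_pos.trans_le hv)).continuousAt.continuousWithinAt)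
          (fun v hv => (dN v (one_pos.trans_le
            (interior_subset hv))).differentiableAt.differentiableWithinAt) ?_
        intro v hv
        have hv : (1 : ℝ) ≤ v := interior_subset hv
        rw [(dN v (by linarith)).deriv, ← D1]
        exact mD (by simp) (by simp; linarith) hv
      have := this (by simp) h h
      linarith
  have e : u * Real.log u - (u - 1) - (u - 1) ^ 2 / (2 * (1 + (u - 1) / 3)) = N u := by
    simp only [hN]
    have h3 : 1 + (u - 1) / 3 = (u + 2) / 3 := by ring
    rw [h3]
    have : u + 2 ≠ 0 := by positivity
    field_simp
    ring
  linarith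

/-- AM–GM with an explicit defect, obtained by expanding `(U + W - 2√(UW))² ≥ 0`. -/
theorem sqrt_mul_le {U W : ℝ} (hU : 0 ≤ U) (hW : 0 ≤ W) (h : 0 < U + W) :
    Real.sqrt (U * W) ≤ (U + W) / 2 - (U - W) ^ 2 / (4 * (U + W)) := by
  have e : (U + W) / 2 - (U - W) ^ 2 / (4 * (U + W)) =
      ((U + W) ^ 2 + 4 * (U * W)) / (4 * (U + W)) := by
    field_simp; ring
  rw [e, le_div_iff₀ (by positivity)]
  have hs := Real.sq_sqrt (mul_nonneg hU hW)
  nlinarith [sq_nonneg (U + W - 2 * Real.sqrt (U * W))]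

/-! ### Expected decay when the random mass `p` has mean `a` and mean deviation `2ψ`. -/

section Expectation

variable {ι : Type*} [Fintype ι] {k p : ι → ℝ} {a ψ Δ : ℝ}

/-- The loss is exactly the variance of `p`, so the Cauchy–Schwarz bound is used with `β = 0`. -/
theorem sum_mul_one_sub_le (hk : ∀ i, 0 ≤ k i) (hk1 : ∑ i, k i = 1)
    (hp : ∑ i, k i * p i = a) (hψ : ∑ i, k i * |p i - a| = 2 * ψ)
    (hΔ : ∀ i, p i ≠ a → Δ ≤ |p i - a|) :
    ∑ i, k i * (p i * (1 - p i)) ≤ a * (1 - a) - 4 * (ψ * max ψ (Δ / 2)) := by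
  have hX0 : ∑ i, k i * (p i - a) = 0 := by
    simp [mul_sub, Finset.sum_sub_distrib, hp, ← Finset.sum_mul, hk1]
  have := four_mul_le_sum_sq_div (β := 0) hk hk1 hX0 hψ (fun i h => hΔ i (sub_ne_zero.1 h))
    (fun i => by simp)
  simp only [zero_mul, add_zero, div_one] at this
  have e : ∀ i, k i * (p i * (1 - p i)) =
      (1 - 2 * a) * (k i * p i) + a ^ 2 * k i - k i * (p i - a) ^ 2 := fun i => by ring
  simp only [e, Finset.sum_sub_distrib, Finset.sum_add_distrib, ← Finset.mul_sum, hp, hk1]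
  linarith

/-- Applying `sq_div_le_mul_log` at `u = p/a` produces the denominator `1 + (p-a)/(3a)`, which
dictates `β = 1/(3a)`. -/
theorem sum_mul_neg_log_le (hk : ∀ i, 0 ≤ k i) (hk1 : ∑ i, k i = 1)
    (hp : ∑ i, k i * p i = a) (hψ : ∑ i, k i * |p i - a| = 2 * ψ)
    (hΔ : ∀ i, p i ≠ a → Δ ≤ |p i - a|) (ha : 0 < a) (hp0 : ∀ i, 0 ≤ p i) :
    ∑ i, k i * (p i * -Real.log (p i)) ≤
      a * -Real.log a - 2 * (ψ * max ψ (Δ / 2)) / a := by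
  have hX0 : ∑ i, k i * (p i - a) = 0 := by
    simp [mul_sub, Finset.sum_sub_distrib, hp, ← Finset.sum_mul, hk1]
  have hβ : ∀ i, 0 < 1 + 1 / (3 * a) * (p i - a) := fun i => by
    have : 1 + 1 / (3 * a) * (p i - a) = (2 * a + p i) / (3 * a) := by field_simp; ring
    rw [this]
    have := hp0 i
    positivity
  have h4 := four_mul_le_sum_sq_div (β := 1 / (3 * a)) hk hk1 hX0 hψ
    (fun i h => hΔ i (sub_ne_zero.1 h)) hβ
  have hi : ∀ i, k i * (p i * -Real.log (p i)) ≤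
      (1 - Real.log a) * (k i * p i) * 1 - (k i * p i) * 1 - k i * (p i - a) -
        (1 / (2 * a)) * (k i * ((p i - a) ^ 2 / (1 + 1 / (3 * a) * (p i - a)))) := by
    intro i
    have h := sq_div_le_mul_log (u := p i / a) (div_nonneg (hp0 i) ha.le)
    have e1 : (p i / a - 1) ^ 2 / (2 * (1 + (p i / a - 1) / 3)) =
        1 / (2 * a ^ 2) * ((p i - a) ^ 2 / (1 + 1 / (3 * a) * (p i - a))) := by
      have h1 := hβ i
      have h2 : 1 + (p i / a - 1) / 3 = 1 + 1 / (3 * a) * (p i - a) := by field_simp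
      rw [h2]
      field_simp
    have e2 : p i / a * Real.log (p i / a) = p i / a * (Real.log (p i) - Real.log a) := by
      rcases (hp0 i).eq_or_lt with h0 | h0
      · simp [← h0]
      · rw [Real.log_div h0.ne' ha.ne']
    rw [e1, e2] at h
    have h' := mul_le_mul_of_nonneg_left h (mul_nonneg (hk i) ha.le)
    have e3 : k i * a * (p i / a * (Real.log (p i) - Real.log a) - (p i / a - 1)) =
        k i * (p i * (Real.log (p i) - Real.log a)) - k i * (p i - a) := by
      field_simp
    have e4 : k i * a * (1 / (2 * a ^ 2) * ((p i - a) ^ 2 / (1 + 1 / (3 * a) * (p i - a)))) =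
        (1 / (2 * a)) * (k i * ((p i - a) ^ 2 / (1 + 1 / (3 * a) * (p i - a)))) := by
      generalize (p i - a) ^ 2 / (1 + 1 / (3 * a) * (p i - a)) = z
      field_simp
    rw [e3, e4] at h'
    linarith
  refine (Finset.sum_le_sum fun i _ => hi i).trans ?_
  simp only [Finset.sum_sub_distrib, ← Finset.mul_sum, mul_one, hX0, hp]
  have := mul_le_mul_of_nonneg_left h4 (by positivity : 0 ≤ 1 / (2 * a))
  have e : 1 / (2 * a) * (4 * (ψ * max ψ (Δ / 2))) = 2 * (ψ * max ψ (Δ / 2)) / a := by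
    field_simp; ring
  linarith

/-- `sqrt_mul_le` is used with `U = p/a` and `W = (1-p)/(1-a)`: then `(U+W)/2 = 1 + β(p-a)` has mean
one, and `U - W = (p-a)/(a(1-a))`. -/
theorem sum_sqrt_le (hk : ∀ i, 0 ≤ k i) (hk1 : ∑ i, k i = 1)
    (hp : ∑ i, k i * p i = a) (hψ : ∑ i, k i * |p i - a| = 2 * ψ)
    (hΔ : ∀ i, p i ≠ a → Δ ≤ |p i - a|) (ha : 0 < a) (ha1 : a < 1) (hp0 : ∀ i, 0 ≤ p i)
    (hp1 : ∀ i, p i ≤ 1) :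
    ∑ i, k i * Real.sqrt (p i * (1 - p i)) ≤
      Real.sqrt (a * (1 - a)) * (1 - (ψ * max ψ (Δ / 2)) / (2 * (a * (1 - a)) ^ 2)) := by
  have hX0 : ∑ i, k i * (p i - a) = 0 := by
    simp [mul_sub, Finset.sum_sub_distrib, hp, ← Finset.sum_mul, hk1]
  have hb : 0 < 1 - a := by linarith
  set β := (1 - 2 * a) / (2 * (a * (1 - a))) with hβd
  have eUW : ∀ i, p i / a + (1 - p i) / (1 - a) = 2 * (1 + β * (p i - a)) := fun i => by
    rw [hβd]; field_simp; ring
  have hU : ∀ i, 0 ≤ p i / a := fun i => div_nonneg (hp0 i) ha.le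
  have hW : ∀ i, 0 ≤ (1 - p i) / (1 - a) := fun i => div_nonneg (by linarith [hp1 i]) hb.le
  have hUW : ∀ i, 0 < p i / a + (1 - p i) / (1 - a) := fun i => by
    rcases (hp0 i).eq_or_lt with h | h
    · simp [← h, ha1]
    · exact add_pos_of_pos_of_nonneg (div_pos h ha) (hW i)
  have hβ : ∀ i, 0 < 1 + β * (p i - a) := fun i => by
    have := hUW i
    rw [eUW] at this
    linarith
  have h4 := four_mul_le_sum_sq_div (β := β) hk hk1 hX0 hψ
    (fun i h => hΔ i (sub_ne_zero.1 h)) hβ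
  have hi : ∀ i, k i * Real.sqrt (p i * (1 - p i)) ≤ Real.sqrt (a * (1 - a)) *
      (k i + β * (k i * (p i - a)) - 1 / (8 * (a * (1 - a)) ^ 2) *
        (k i * ((p i - a) ^ 2 / (1 + β * (p i - a))))) := by
    intro i
    have h := sqrt_mul_le (hU i) (hW i) (hUW i)
    have e1 : p i * (1 - p i) = (a * (1 - a)) * (p i / a * ((1 - p i) / (1 - a))) := by
      field_simp
    have e2 : p i / a - (1 - p i) / (1 - a) = (p i - a) / (a * (1 - a)) := by
      field_simp; ring
    rw [eUW, e2] at h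
    rw [e1, Real.sqrt_mul (by positivity)]
    have e3 : k i + β * (k i * (p i - a)) - 1 / (8 * (a * (1 - a)) ^ 2) *
        (k i * ((p i - a) ^ 2 / (1 + β * (p i - a)))) =
        k i * (2 * (1 + β * (p i - a)) / 2 -
          ((p i - a) / (a * (1 - a))) ^ 2 / (4 * (2 * (1 + β * (p i - a))))) := by
      have hk' : k i + β * (k i * (p i - a)) = k i * (1 + β * (p i - a)) := by ring
      have hL := (hβ i).ne'
      rw [hk']
      generalize 1 + β * (p i - a) = L at hL
      field_simp
      ring
    rw [e3, mul_left_comm]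
    exact mul_le_mul_of_nonneg_left (mul_le_mul_of_nonneg_left h (hk i)) (Real.sqrt_nonneg _)
  refine (Finset.sum_le_sum fun i _ => hi i).trans ?_
  rw [← Finset.mul_sum]
  refine mul_le_mul_of_nonneg_left ?_ (Real.sqrt_nonneg _)
  simp only [Finset.sum_sub_distrib, Finset.sum_add_distrib, ← Finset.mul_sum, hX0, hk1]
  have := mul_le_mul_of_nonneg_left h4 (by positivity : 0 ≤ 1 / (8 * (a * (1 - a)) ^ 2))
  have e : 1 / (8 * (a * (1 - a)) ^ 2) * (4 * (ψ * max ψ (Δ / 2))) =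
      (ψ * max ψ (Δ / 2)) / (2 * (a * (1 - a)) ^ 2) := by
    generalize ψ * max ψ (Δ / 2) = z
    field_simp; ring
  linarith

end Expectation

end Analysis

/-! ### Integrating the decay recursion. -/

section Rates

/-- `g` bounds the decay of a distance taking values in `R`: above `b` it is used as it stands,
with potential `F` (so that `-F' = 1 / g`), and below `b` it is replaced by the line `c * y`. -/
structure IsRate (R : Set ℝ) (g F : ℝ → ℝ) (b c : ℝ) : Prop where
  convex : Convex ℝ R
  nonneg : ∀ y ∈ R, 0 ≤ y
  b_pos : 0 < b
  c_pos : 0 < c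
  low : ∀ y ∈ R, 0 < y → c * y ≤ g y
  tangent : ∀ x ∈ R, b ≤ x → ∃ s, g x ≤ s * x ∧ ∀ y ∈ R, 0 < y → g x + s * (y - x) ≤ g y
  potential : ∀ x y, b ≤ x → x ≤ y → y ∈ R → y - x ≤ g y * (F x - F y)

namespace IsRate

variable {R : Set ℝ} {g F : ℝ → ℝ} {b c κ ε : ℝ} {I : ℕ → ℝ}

/-- `Φ` is an antiderivative of `1/ĝ`, where `ĝ` is `c y` up to `b` and `g` beyond. The bound is the
integral of `1/ĝ` over `[x,y]` estimated from below by its value at `y`; when `b` separates `x` from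
`y` the interval is split there. -/
theorem mul_le (hr : IsRate R g F b c) {Φ : ℝ → ℝ}
    (hΦ : Φ = fun y => if y ≤ b then Real.log (y / b) / c else F b - F y)
    {x y : ℝ} (hx : 0 < x) (hxy : x ≤ y) (hy : y ∈ R) :
    y - x ≤ (if y ≤ b then c * y else g y) * (Φ y - Φ x) := by
  have hb := hr.b_pos
  have hc := hr.c_pos
  have hlog : ∀ z, 0 < z → z - x ≤ z * (Real.log (z / b) - Real.log (x / b)) := by
    intro z hz
    have h := Real.one_sub_inv_le_log_of_pos (div_pos hz hx)
    rw [Real.log_div hz.ne' hx.ne'] at h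
    rw [Real.log_div hz.ne' hb.ne', Real.log_div hx.ne' hb.ne']
    have h2 := mul_le_mul_of_nonneg_left h hz.le
    have e : z * (1 - (z / x)⁻¹) = z - x := by field_simp
    linarith
  have hy0 : 0 < y := hx.trans_le hxy
  subst hΦ
  by_cases h1 : y ≤ b
  · have h2 : x ≤ b := hxy.trans h1
    simp only [h1, h2, if_true]
    have := hlog y hy0
    have e : c * y * (Real.log (y / b) / c - Real.log (x / b) / c) =
        y * (Real.log (y / b) - Real.log (x / b)) := by field_simp
    linarith
  · by_cases h2 : x ≤ b
    · simp only [h1, h2, if_true, if_false]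
      have hby := (not_le.1 h1).le
      have h3 := hr.potential b y le_rfl hby hy
      have h4 := hlog b hb
      have h5 := hr.low y hy hy0
      rw [div_self hb.ne', Real.log_one] at h4
      have h6 : 0 ≤ -Real.log (x / b) / c := by
        refine div_nonneg (neg_nonneg.2 (Real.log_nonpos (by positivity) ?_)) hc.le
        rwa [div_le_one hb]
      have h7 : c * b ≤ g y := (mul_le_mul_of_nonneg_left hby hc.le).trans h5
      have h8 := mul_le_mul_of_nonneg_right h7 h6
      have e : c * b * (-Real.log (x / b) / c) = b * (0 - Real.log (x / b)) := by
        field_simp; ring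
      have e2 : g y * (F b - F y - Real.log (x / b) / c) =
        g y * (F b - F y) + g y * (-Real.log (x / b) / c) := by ring
      linarith
    · simp only [h1, h2, if_false]
      have := hr.potential x y (not_le.1 h2).le hxy hy
      have e : F b - F y - (F b - F x) = F x - F y := by ring
      rwa [e]

/-- Each step lowers `Φ(I)` by at least `κ`. The final strict inequality comes from `ε < I t`, so a
non-strict time budget suffices to contradict it. -/
theorem mul_lt_of_lt (hr : IsRate R g F b c) (hκ : 0 ≤ κ) (hI : ∀ t, I t ∈ R)
    (hlow : ∀ t, I (t + 1) ≤ I t - κ * (c * I t))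
    (hhigh : ∀ t, b ≤ I t → I (t + 1) ≤ I t - κ * g (I t)) {Φ : ℝ → ℝ}
    (hΦ : Φ = fun y => if y ≤ b then Real.log (y / b) / c else F b - F y)
    (hε : 0 < ε) {t : ℕ} (ht : ε < I t) : ε < I 0 ∧ κ * t < Φ (I 0) - Φ ε := by
  have hpos : ∀ y ∈ R, 0 < y → 0 < if y ≤ b then c * y else g y := by
    intro y hy h0
    have h1 := mul_pos hr.c_pos h0
    split_ifs
    · exact h1
    · exact h1.trans_le (hr.low y hy h0)
  have hanti : ∀ t, I (t + 1) ≤ I t := fun t => by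
    have := mul_nonneg hκ (mul_nonneg hr.c_pos.le (hr.nonneg _ (hI t)))
    linarith [hlow t]
  have hind : ∀ t : ℕ, 0 < I t → κ * t ≤ Φ (I 0) - Φ (I t) := by
    intro t
    induction t with
    | zero => simp
    | succ t ih =>
      intro h
      have h0 : 0 < I t := h.trans_le (hanti t)
      have h1 := hr.mul_le hΦ h (hanti t) (hI t)
      have h2 := hpos _ (hI t) h0
      have h3 : I (t + 1) ≤ I t - κ * (if I t ≤ b then c * I t else g (I t)) := by
        split_ifs with hb
        · exact hlow t
        · exact hhigh t (not_le.1 hb).le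
      have h4 : κ ≤ Φ (I t) - Φ (I (t + 1)) := by
        refine le_of_mul_le_mul_left ?_ h2
        rw [mul_comm]
        linarith
      have := ih h0
      push_cast
      linarith
  have h1 := hind t (hε.trans ht)
  have h2 := hr.mul_le hΦ hε ht.le (hI t)
  have h3 := hpos _ (hI t) (hε.trans ht)
  have h4 : 0 < Φ (I t) - Φ ε := by
    refine pos_of_mul_pos_right (lt_of_lt_of_le (sub_pos.2 ht) h2) h3.le
  exact ⟨ht.trans_le (antitone_nat_of_succ_le hanti (Nat.zero_le t)), by linarith⟩

theorem le_of_low (hr : IsRate R g F b c) (hκ : 0 ≤ κ) (hI : ∀ t, I t ∈ R)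
    (hlow : ∀ t, I (t + 1) ≤ I t - κ * (c * I t))
    (hhigh : ∀ t, b ≤ I t → I (t + 1) ≤ I t - κ * g (I t)) (hε : 0 < ε) (hεb : ε ≤ b)
    {M : ℝ} (hM0 : 0 ≤ M) (hM : b ≤ I 0 → F b - F (I 0) ≤ M) {t : ℕ}
    (ht : M + Real.log (b / ε) / c ≤ κ * t) : I t ≤ ε := by
  by_contra! h
  obtain ⟨h0, h1⟩ := hr.mul_lt_of_lt hκ hI hlow hhigh rfl hε h
  have hb := hr.b_pos
  -- If the start is already below `b`, then `Φ(I 0) ≤ 0`, and only `M ≥ 0` is needed.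
  have h2 : (if I 0 ≤ b then Real.log (I 0 / b) / c else F b - F (I 0)) ≤ M := by
    split_ifs with h
    · refine le_trans (div_nonpos_of_nonpos_of_nonneg (Real.log_nonpos ?_ ?_) hr.c_pos.le) hM0
      · exact div_nonneg (hε.trans h0).le hb.le
      · rwa [div_le_one hb]
    · exact hM (not_le.1 h).le
  have e : Real.log (b / ε) = -Real.log (ε / b) := by rw [← Real.log_inv, inv_div]
  rw [e, neg_div] at ht
  simp only [hεb, if_true] at h1
  linarith

theorem le_of_high (hr : IsRate R g F b c) (hκ : 0 ≤ κ) (hI : ∀ t, I t ∈ R)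
    (hlow : ∀ t, I (t + 1) ≤ I t - κ * (c * I t))
    (hhigh : ∀ t, b ≤ I t → I (t + 1) ≤ I t - κ * g (I t)) (hεb : b < ε)
    {t : ℕ} (ht : ε < I 0 → F ε - F (I 0) ≤ κ * t) : I t ≤ ε := by
  by_contra! h
  obtain ⟨h0, h1⟩ := hr.mul_lt_of_lt hκ hI hlow hhigh rfl (hr.b_pos.trans hεb) h
  simp only [not_le.2 hεb, not_le.2 (hεb.trans h0), if_false] at h1
  linarith [ht h0]

end IsRate

/-! ### The rates for total variation, relative entropy and `L²`; in each, `b` minimises `g(y)/y`.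
-/

theorem isRate_tv : IsRate (Set.Ico 0 1) (fun y => 4 / (1 - y)) (fun y => (1 - y) ^ 2 / 8)
    (1 / 2) 16 where
  convex := convex_Ico 0 1
  nonneg y hy := hy.1
  b_pos := by norm_num
  c_pos := by norm_num
  low y hy _ := by
    rw [le_div_iff₀ (by linarith [hy.2])]
    nlinarith [sq_nonneg (2 * y - 1)]
  tangent x hx hb := by
    have h1 : 0 < 1 - x := by linarith [hx.2]
    refine ⟨4 / (1 - x) ^ 2, ?_, fun y hy _ => ?_⟩
    · rw [div_mul_eq_mul_div, div_le_div_iff₀ h1 (by positivity)]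
      nlinarith
    · have h2 : 0 < 1 - y := by linarith [hy.2]
      have e : 4 / (1 - y) - (4 / (1 - x) + 4 / (1 - x) ^ 2 * (y - x)) =
          4 * (y - x) ^ 2 / ((1 - y) * (1 - x) ^ 2) := by
        field_simp; ring
      have : 0 ≤ 4 * (y - x) ^ 2 / ((1 - y) * (1 - x) ^ 2) := by positivity
      linarith
  potential x y _ hxy hy := by
    have h2 : 0 < 1 - y := by linarith [hy.2]
    have e : 4 / (1 - y) * ((1 - x) ^ 2 / 8 - (1 - y) ^ 2 / 8) - (y - x) =
        (y - x) ^ 2 / (2 * (1 - y)) := by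
      field_simp; ring
    have : 0 ≤ (y - x) ^ 2 / (2 * (1 - y)) := by positivity
    linarith

theorem isRate_relEntropy : IsRate (Set.Ici 0) (fun y => 2 * Real.exp (2 * y))
    (fun y => Real.exp (-2 * y) / 4) (1 / 2) (4 * Real.exp 1) where
  convex := convex_Ici 0
  nonneg y hy := hy
  b_pos := by norm_num
  c_pos := by positivity
  low y hy _ := by
    have h := Real.add_one_le_exp (2 * y - 1)
    have e : Real.exp (2 * y) = Real.exp 1 * Real.exp (2 * y - 1) := by
      rw [← Real.exp_add]; ring_nf
    rw [e]
    nlinarith [Real.exp_pos 1]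
  tangent x hx hb := by
    refine ⟨4 * Real.exp (2 * x), ?_, fun y hy _ => ?_⟩
    · nlinarith [Real.exp_pos (2 * x)]
    · have h := Real.add_one_le_exp (2 * (y - x))
      have e : Real.exp (2 * y) = Real.exp (2 * x) * Real.exp (2 * (y - x)) := by
        rw [← Real.exp_add]; ring_nf
      rw [e]
      nlinarith [Real.exp_pos (2 * x)]
  potential x y _ hxy hy := by
    have h := Real.add_one_le_exp (2 * (y - x))
    have e1 : Real.exp (2 * y) * Real.exp (-2 * x) = Real.exp (2 * (y - x)) := by
      rw [← Real.exp_add]; ring_nf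
    have e2 : Real.exp (2 * y) * Real.exp (-2 * y) = 1 := by
      rw [← Real.exp_add]; simp
    linear_combination h / 2 - e1 / 2 + e2 / 2

/-- Bernoulli's inequality for `(x/y)^n`, combined with `x/y - 1 ≥ 1 - y/x`. -/
theorem inv_tangent {x y : ℝ} (hx : 0 < x) (hy : 0 < y) (n : ℕ) :
    (x ^ n)⁻¹ - n * (x ^ (n + 1))⁻¹ * (y - x) ≤ (y ^ n)⁻¹ := by
  have hr : 0 < x / y := div_pos hx hy
  have h := one_add_mul_le_pow (a := x / y - 1) (by linarith) n
  have h1 : 1 - y / x ≤ x / y - 1 := by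
    have e : x / y - 1 - (1 - y / x) = (x - y) ^ 2 / (x * y) := by field_simp
    have : 0 ≤ (x - y) ^ 2 / (x * y) := by positivity
    linarith
  have h2 := mul_le_mul_of_nonneg_left h1 (Nat.cast_nonneg (α := ℝ) n)
  have h3 : 1 + n * (1 - y / x) ≤ (x / y) ^ n := by
    rw [add_sub_cancel] at h
    linarith
  have h4 := mul_le_mul_of_nonneg_left h3 (inv_pos.2 (pow_pos hx n)).le
  have e : (x ^ n)⁻¹ * (x / y) ^ n = (y ^ n)⁻¹ := by rw [div_pow]; field_simp
  rw [e] at h4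
  refine le_trans (le_of_eq ?_) h4
  field_simp
  ring

theorem pow_tangent {x y : ℝ} (hx : 0 < x) (hy : 0 < y) (n : ℕ) :
    x ^ (n + 1) + (n + 1) * x ^ n * (y - x) ≤ y ^ (n + 1) := by
  have h := one_add_mul_le_pow (a := y / x - 1) (by have := div_pos hy hx; linarith) (n + 1)
  have h' := mul_le_mul_of_nonneg_left h (pow_pos hx (n + 1)).le
  have e : x ^ (n + 1) * (1 + (y / x - 1)) ^ (n + 1) = y ^ (n + 1) := by
    rw [← mul_pow]; congr 1; field_simp; ring
  rw [e] at h'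
  refine le_trans (le_of_eq ?_) h'
  push_cast
  field_simp
  ring

theorem isRate_l2 : IsRate (Set.Ici 0) (fun y => (1 + y ^ 2) ^ 4 / (2 * y ^ 3))
    (fun y => (1 + 3 * y ^ 2) / (6 * (1 + y ^ 2) ^ 3)) 1 8 where
  convex := convex_Ici 0
  nonneg y hy := hy
  b_pos := by norm_num
  c_pos := by norm_num
  low y hy h0 := by
    rw [le_div_iff₀ (by positivity)]
    have : (2 * y) ^ 4 ≤ (1 + y ^ 2) ^ 4 :=
      pow_le_pow_left₀ (by linarith) (by nlinarith [sq_nonneg (y - 1)]) 4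
    linarith
  tangent x hx hb := by
    have hx0 : 0 < x := by linarith
    -- Expanding the numerator writes `g` as a positive combination of powers convex on `(0,∞)`, so
    -- the tangent lines can be added term by term.
    have e : ∀ z : ℝ, 0 < z → (1 + z ^ 2) ^ 4 / (2 * z ^ 3) =
        1 / 2 * ((z ^ 3)⁻¹ + 4 * (z ^ 1)⁻¹ + 6 * z + 4 * z ^ 3 + z ^ 5) := fun z hz => by
      field_simp; ring
    refine ⟨1 / 2 * (-3 * (x ^ 4)⁻¹ - 4 * (x ^ 2)⁻¹ + 6 + 12 * x ^ 2 + 5 * x ^ 4), ?_,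
      fun y hy hy0 => ?_⟩
    · rw [e x hx0]
      have e1 : (x ^ 4)⁻¹ * x = (x ^ 3)⁻¹ := by field_simp
      have e2 : (x ^ 2)⁻¹ * x = (x ^ 1)⁻¹ := by field_simp
      have h1 : (x ^ 3)⁻¹ ≤ 1 := inv_le_one_of_one_le₀ (one_le_pow₀ hb)
      have h2 : (x ^ 1)⁻¹ ≤ 1 := inv_le_one_of_one_le₀ (one_le_pow₀ hb)
      have h3 : 1 ≤ x ^ 3 := one_le_pow₀ hb
      have h4 : 1 ≤ x ^ 5 := one_le_pow₀ hb
      linear_combination 2 * h1 + 4 * h2 + 4 * h3 + 2 * h4 + 3 / 2 * e1 + 2 * e2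
    · have hy0 : 0 < y := hy0
      simp only [e x hx0, e y hy0]
      have h1 := inv_tangent hx0 hy0 3
      have h2 := inv_tangent hx0 hy0 1
      have h3 := pow_tangent hx0 hy0 2
      have h4 := pow_tangent hx0 hy0 4
      norm_num at h1 h2 h3 h4 ⊢
      linarith
  potential x y hx hxy hy := by
    have hx0 : 0 < x := by linarith
    have hy0 : 0 < y := by linarith
    rcases hxy.eq_or_lt with rfl | hlt
    · simp
    have hd : ∀ z : ℝ, HasDerivAt (fun y : ℝ => (1 + 3 * y ^ 2) / (6 * (1 + y ^ 2) ^ 3))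
        (-(2 * z ^ 3 / (1 + z ^ 2) ^ 4)) z := by
      intro z
      have hz : 1 + z ^ 2 ≠ 0 := by positivity
      have h2 : HasDerivAt (fun y : ℝ => y ^ 2) (2 * z) z := by
        simpa using (hasDerivAt_id z).fun_pow 2
      have := ((h2.const_mul 3).const_add 1).fun_div
        (((h2.const_add 1).fun_pow 3).const_mul 6) (by positivity)
      refine this.congr_deriv ?_
      field_simp
      ring
    -- By the mean value theorem the slope of `F` is `-1/g(z)` with `x < z < y`; since `g` increases
    -- on `[1,∞)`, `1/g(z)` may be replaced by `1/g(y)`.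
    obtain ⟨z, hz, he⟩ := exists_hasDerivAt_eq_slope _ _ hlt
      (fun z _ => (hd z).continuousAt.continuousWithinAt) (fun z _ => hd z)
    have hz0 : 0 < z := hx0.trans hz.1
    have hmono : 2 * y ^ 3 / (1 + y ^ 2) ^ 4 ≤ 2 * z ^ 3 / (1 + z ^ 2) ^ 4 := by
      have h1 : y / (1 + y ^ 2) ≤ z / (1 + z ^ 2) := by
        rw [div_le_div_iff₀ (by positivity) (by positivity)]
        have : 1 ≤ y * z := one_le_mul_of_one_le_of_one_le (by linarith) (by linarith [hz.1])
        nlinarith [mul_nonneg (sub_nonneg.2 hz.2.le) (sub_nonneg.2 this)]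
      have h2 : 1 / (1 + y ^ 2) ≤ 1 / (1 + z ^ 2) :=
        one_div_le_one_div_of_le (by positivity) (by nlinarith [hz.2])
      have h3 := mul_le_mul (pow_le_pow_left₀ (by positivity) h1 3) h2 (by positivity)
        (by positivity)
      have e : ∀ v : ℝ, 2 * v ^ 3 / (1 + v ^ 2) ^ 4 =
          2 * ((v / (1 + v ^ 2)) ^ 3 * (1 / (1 + v ^ 2))) := fun v => by
        have : 1 + v ^ 2 ≠ 0 := by positivity
        field_simp
      rw [e, e]
      linarith
    rw [eq_div_iff (sub_pos.2 hlt).ne'] at he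
    have h5 := mul_le_mul_of_nonneg_right hmono (sub_pos.2 hlt).le
    have h6 : 2 * y ^ 3 / (1 + y ^ 2) ^ 4 * (y - x) ≤ (1 + 3 * x ^ 2) / (6 * (1 + x ^ 2) ^ 3) -
        (1 + 3 * y ^ 2) / (6 * (1 + y ^ 2) ^ 3) := by linarith
    have h7 := mul_le_mul_of_nonneg_left h6
      (by positivity : 0 ≤ (1 + y ^ 2) ^ 4 / (2 * y ^ 3))
    refine le_trans (le_of_eq ?_) h7
    field_simp

end Rates

/-! ### The evolving set process and its Doob transform. -/

section Chain

open MeasureTheory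

theorem gapMin_le {V : Type*} {π : V → ℝ} {A B : Finset V} (h : mass π B ≠ mass π A) :
    gapMin π ≤ |mass π B - mass π A| :=
  ciInf_le (f := fun p : {p : Finset V × Finset V // mass π p.1 ≠ mass π p.2} =>
      |mass π p.1.1 - mass π p.1.2|)
    ⟨0, by rintro _ ⟨p, rfl⟩; exact abs_nonneg _⟩ ⟨(B, A), h⟩

theorem modFlow_nonneg {V : Type*} [Fintype V] {P : Matrix V V ℝ} {π : V → ℝ} (A : Finset V) :
    0 ≤ modFlow P π A :=
  mul_nonneg (by norm_num) (intervalIntegral.integral_nonneg zero_le_one fun _ _ => abs_nonneg _)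

section ModFlow

variable {V : Type*} [Fintype V] {P : Matrix V V ℝ} {π : V → ℝ}

theorem modFlowMin_nonneg : 0 ≤ modFlowMin P π := Real.iInf_nonneg fun A => modFlow_nonneg A.1

theorem modFlowMin_le {A : Finset V} (hA : A.Nonempty) (hA' : A ≠ Finset.univ) :
    modFlowMin P π ≤ modFlow P π A :=
  ciInf_le (f := fun A : {A : Finset V // A.Nonempty ∧ A ≠ Finset.univ} => modFlow P π A.1)
    ⟨0, by rintro _ ⟨B, rfl⟩; exact modFlow_nonneg B.1⟩ ⟨A, hA, hA'⟩

theorem aMax_nonneg : 0 ≤ aMax P π := modFlowMin_nonneg.trans (le_max_left _ _)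

theorem modFlowMin_mul_aMax_le {A : Finset V} (hA : A.Nonempty) (hA' : A ≠ Finset.univ) :
    modFlowMin P π * aMax P π ≤ modFlow P π A * max (modFlow P π A) (gapMin π / 2) :=
  mul_le_mul (modFlowMin_le hA hA') (max_le_max_right _ (modFlowMin_le hA hA')) aMax_nonneg
    (modFlow_nonneg A)

end ModFlow

variable {V : Type*} [Fintype V] [DecidableEq V] {P : Matrix V V ℝ} {π : V → ℝ}

namespace IsMarkovChain

theorem sum_mul_eq (hP : IsMarkovChain P π) (y : V) : ∑ x, π x * P x y = π y := by
  conv_rhs => rw [← hP.stationary]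
  rfl

theorem pow_nonneg (hP : IsMarkovChain P π) (t : ℕ) : ∀ x y, 0 ≤ (P ^ t) x y := by
  induction t with
  | zero => intro x y; simp only [pow_zero, one_apply]; split_ifs <;> norm_num
  | succ t ih =>
    intro x y
    rw [pow_succ, mul_apply]
    exact Finset.sum_nonneg fun z _ => mul_nonneg (ih x z) (hP.nonneg z y)

theorem vecMul_pow (hP : IsMarkovChain P π) (t : ℕ) : π ᵥ* P ^ t = π := by
  induction t with
  | zero => simp
  | succ t ih => rw [pow_succ, ← vecMul_vecMul, ih, hP.stationary]

/-- Irreducibility carries mass to `y` from some state of positive mass, and `π` is invariant under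
every power of `P`. -/
theorem pi_pos (hP : IsMarkovChain P π) (y : V) : 0 < π y := by
  obtain ⟨x, hx⟩ : ∃ x, 0 < π x := by
    by_contra! h
    have := Finset.sum_nonpos fun x (_ : x ∈ Finset.univ) => h x
    rw [hP.pi_sum] at this
    linarith
  obtain ⟨t, ht⟩ := hP.irreducible x y
  have h : ∑ z, π z * (P ^ t) z y = π y := by
    conv_rhs => rw [← hP.vecMul_pow t]
    rfl
  rw [← h]
  exact Finset.sum_pos' (fun z _ => mul_nonneg (hP.pi_nonneg z) (hP.pow_nonneg t z y))
    ⟨x, Finset.mem_univ x, mul_pos hx ht⟩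

theorem mass_pos (hP : IsMarkovChain P π) {A : Finset V} (hA : A.Nonempty) : 0 < mass π A :=
  Finset.sum_pos (fun x _ => hP.pi_pos x) hA

theorem mass_nonneg (hP : IsMarkovChain P π) (A : Finset V) : 0 ≤ mass π A :=
  Finset.sum_nonneg fun x _ => hP.pi_nonneg x

theorem mass_univ (hP : IsMarkovChain P π) : mass π Finset.univ = 1 := hP.pi_sum

theorem mass_add_compl (hP : IsMarkovChain P π) (A : Finset V) : mass π A + mass π Aᶜ = 1 := by
  rw [← hP.pi_sum]
  exact Finset.sum_add_sum_compl A π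

theorem mass_le_one (hP : IsMarkovChain P π) (A : Finset V) : mass π A ≤ 1 := by
  linarith [hP.mass_add_compl A, hP.mass_nonneg Aᶜ]

theorem mass_lt_one (hP : IsMarkovChain P π) {A : Finset V} (hA : A ≠ Finset.univ) :
    mass π A < 1 := by
  have h : Aᶜ.Nonempty := by
    rw [Finset.nonempty_iff_ne_empty]
    simpa using hA
  linarith [hP.mass_add_compl A, hP.mass_pos h]

theorem flow_nonneg (hP : IsMarkovChain P π) (A : Finset V) (v : V) : 0 ≤ flow P π A {v} :=
  Finset.sum_nonneg fun x _ => Finset.sum_nonneg fun y _ =>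
    mul_nonneg (hP.pi_nonneg x) (hP.nonneg x y)

theorem flow_singleton_le (hP : IsMarkovChain P π) (A : Finset V) (v : V) :
    flow P π A {v} ≤ π v := by
  rw [← hP.sum_mul_eq v]
  simp only [flow, Finset.sum_singleton]
  exact Finset.sum_le_sum_of_subset_of_nonneg (Finset.subset_univ A)
    fun x _ _ => mul_nonneg (hP.pi_nonneg x) (hP.nonneg x v)

theorem sum_flow (hP : IsMarkovChain P π) (A : Finset V) :
    ∑ v, flow P π A {v} = mass π A := by
  simp only [flow, Finset.sum_singleton, mass]
  rw [Finset.sum_comm]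
  simp only [← Finset.mul_sum, hP.row_sum, mul_one]

end IsMarkovChain

/-- Transition probabilities of the evolving set process. -/
noncomputable def levelProb (P : Matrix V V ℝ) (π : V → ℝ) (A B : Finset V) : ℝ :=
  ∫ u in (0 : ℝ)..1, if levelSet P π A u = B then 1 else 0

theorem measurableSet_levelSet_eq (P : Matrix V V ℝ) (π : V → ℝ) (A B : Finset V) :
    MeasurableSet {u : ℝ | levelSet P π A u = B} := by
  have : {u : ℝ | levelSet P π A u = B} =
      ⋂ v, {u : ℝ | u * π v ≤ flow P π A {v} ↔ v ∈ B} := by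
    ext u
    simp [levelSet, Finset.ext_iff]
  rw [this]
  refine MeasurableSet.iInter fun v => ?_
  have hm : MeasurableSet {u : ℝ | u * π v ≤ flow P π A {v}} :=
    measurableSet_le (by fun_prop) (by fun_prop)
  by_cases h : v ∈ B
  · simpa [h] using hm
  · simpa [h, Set.compl_ofPred] using hm.compl

/-- Only finitely many sets occur as `A_u`, so integrals over `u` become finite sums against the
transition law. -/
theorem intervalIntegral_levelSet (P : Matrix V V ℝ) (π : V → ℝ) (A : Finset V)
    (g : Finset V → ℝ) :
    ∫ u in (0 : ℝ)..1, g (levelSet P π A u) = ∑ B, levelProb P π A B * g B := by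
  have h : ∀ u, g (levelSet P π A u) =
      ∑ B, (if levelSet P π A u = B then (1 : ℝ) else 0) * g B := by simp
  simp only [h, levelProb, ← intervalIntegral.integral_mul_const]
  refine intervalIntegral.integral_finsetSum fun B _ => ?_
  refine IntervalIntegrable.mul_const ?_ _
  rw [intervalIntegrable_iff]
  have : (fun u : ℝ => if levelSet P π A u = B then (1 : ℝ) else 0) =
      Set.indicator {u : ℝ | levelSet P π A u = B} (fun _ => 1) := by
    ext u; simp [Set.indicator_apply]
  rw [this]
  refine IntegrableOn.indicator ?_ (measurableSet_levelSet_eq P π A B)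
  simp

theorem levelProb_nonneg (A B : Finset V) : 0 ≤ levelProb P π A B :=
  intervalIntegral.integral_nonneg zero_le_one fun u _ => by split_ifs <;> norm_num

theorem sum_levelProb (A : Finset V) : ∑ B, levelProb P π A B = 1 := by
  simpa using (intervalIntegral_levelSet P π A fun _ => 1).symm

theorem sum_levelProb_mul_abs (A : Finset V) :
    ∑ B, levelProb P π A B * |mass π B - mass π A| = 2 * modFlow P π A := by
  rw [← intervalIntegral_levelSet P π A fun B => |mass π B - mass π A|, modFlow]
  ring

namespace IsMarkovChain

theorem sum_levelProb_mem (hP : IsMarkovChain P π) (A : Finset V) (v : V) :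
    ∑ B, levelProb P π A B * (if v ∈ B then 1 else 0) = flow P π A {v} / π v := by
  rw [← intervalIntegral_levelSet P π A fun B => if v ∈ B then 1 else 0]
  have hv := hP.pi_pos v
  obtain ⟨q, hq⟩ : ∃ q, q = flow P π A {v} / π v := ⟨_, rfl⟩
  have hq0 : 0 ≤ q := hq ▸ div_nonneg (hP.flow_nonneg A v) hv.le
  have hq1 : q ≤ 1 := by rw [hq, div_le_one hv]; exact hP.flow_singleton_le A v
  have h : (fun u : ℝ => if v ∈ levelSet P π A u then (1 : ℝ) else 0) =
      Set.indicator (Set.Iic q) 1 := by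
    ext u
    simp [levelSet, Set.indicator_apply, hq, le_div_iff₀ hv]
  rw [← hq, h, intervalIntegral.integral_of_le zero_le_one, integral_indicator_one measurableSet_Iic,
    measureReal_restrict_apply measurableSet_Iic, Set.inter_comm, Set.Ioc_inter_Iic, inf_eq_right.2 hq1]
  simp [hq0]

/-- The martingale property: a state `v` lies in `A_u` with probability `Q(A,v)/π(v)`, and summing
against `π(v)` recovers `π(A)`. -/
theorem sum_levelProb_mul_mass (hP : IsMarkovChain P π) (A : Finset V) :
    ∑ B, levelProb P π A B * mass π B = mass π A := by
  have h : ∀ B : Finset V, mass π B = ∑ v, π v * (if v ∈ B then 1 else 0) := by simp [mass]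
  simp only [h, Finset.mul_sum]
  rw [Finset.sum_comm]
  simp only [mul_left_comm _ (π _), ← Finset.mul_sum, hP.sum_levelProb_mem]
  rw [← h, ← hP.sum_flow]
  refine Finset.sum_congr rfl fun v _ => ?_
  have := (hP.pi_pos v).ne'
  field_simp

/-- `V` is absorbing: the martingale starts at its maximal value `1`, so it cannot move. -/
theorem levelProb_univ (hP : IsMarkovChain P π) {B : Finset V} (hB : B ≠ Finset.univ) :
    levelProb P π Finset.univ B = 0 := by
  have h0 : ∑ B, levelProb P π Finset.univ B * (1 - mass π B) = 0 := by
    simp [mul_sub, Finset.sum_sub_distrib, sum_levelProb, hP.sum_levelProb_mul_mass, hP.mass_univ]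
  have h1 := (Finset.sum_eq_zero_iff_of_nonneg fun B _ => mul_nonneg (levelProb_nonneg _ B)
    (by linarith [hP.mass_le_one B])).1 h0 B (Finset.mem_univ B)
  rcases mul_eq_zero.1 h1 with h | h
  · exact h
  · linarith [hP.mass_lt_one hB]

end IsMarkovChain

/-- The law at time `t` of the Doob transform of the evolving set process started at `{x}`. -/
noncomputable def setLaw (P : Matrix V V ℝ) (π : V → ℝ) (x : V) : ℕ → Finset V → ℝ
  | 0, A => if A = {x} then 1 else 0
  | t + 1, B => ∑ A, setLaw P π x t A * (levelProb P π A B * mass π B / mass π A)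

/-- The expectation of `G (π(S_t))` under `setLaw`. -/
noncomputable def setMean (P : Matrix V V ℝ) (π : V → ℝ) (x : V) (G : ℝ → ℝ) (t : ℕ) : ℝ :=
  ∑ A, setLaw P π x t A * G (mass π A)

theorem setMean_zero (x : V) (G : ℝ → ℝ) : setMean P π x G 0 = G (π x) := by
  simp [setMean, setLaw, mass]

/-- The Doob factor `π(B)` kills the empty set, so the divisions by `π(A) = 0` there are harmless.
-/
theorem setLaw_empty (x : V) (t : ℕ) : setLaw P π x t ∅ = 0 := by
  cases t with
  | zero => simp [setLaw, (Finset.singleton_ne_empty x).symm]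
  | succ t => simp [setLaw, mass]

theorem setMean_succ (x : V) (G : ℝ → ℝ) (t : ℕ) : setMean P π x G (t + 1) =
    ∑ A, setLaw P π x t A *
      ((∑ B, levelProb P π A B * (mass π B * G (mass π B))) / mass π A) := by
  simp only [setMean, setLaw, Finset.sum_mul, Finset.sum_div, Finset.mul_sum]
  rw [Finset.sum_comm]
  refine Finset.sum_congr rfl fun A _ => Finset.sum_congr rfl fun B _ => ?_
  ring

namespace IsMarkovChain

theorem setLaw_nonneg (hP : IsMarkovChain P π) (x : V) (t : ℕ) :
    ∀ A, 0 ≤ setLaw P π x t A := by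
  induction t with
  | zero => intro A; simp only [setLaw]; split_ifs <;> norm_num
  | succ t ih =>
    exact fun B => Finset.sum_nonneg fun A _ => mul_nonneg (ih A)
      (div_nonneg (mul_nonneg (levelProb_nonneg A B) (hP.mass_nonneg B)) (hP.mass_nonneg A))

theorem sum_setLaw (hP : IsMarkovChain P π) (x : V) (t : ℕ) : ∑ A, setLaw P π x t A = 1 := by
  induction t with
  | zero => simp [setLaw]
  | succ t ih =>
    have h := setMean_succ (P := P) (π := π) x (fun _ => 1) t
    simp only [setMean, mul_one, hP.sum_levelProb_mul_mass] at h
    rw [h, ← ih]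
    refine Finset.sum_congr rfl fun A _ => ?_
    rcases A.eq_empty_or_nonempty with rfl | hA
    · simp [setLaw_empty]
    · rw [div_self (hP.mass_pos hA).ne', mul_one]

/-- Duality with the chain: the factor `π(B)` cancels the normalisation of the conditioned measure,
and what remains, `P(y ∈ A_u) π(y) = Q(A,y)`, is one step of `P`. -/
theorem pow_apply_eq (hP : IsMarkovChain P π) (x : V) (t : ℕ) : ∀ y, (P ^ t) x y =
    ∑ A, setLaw P π x t A * ((if y ∈ A then π y else 0) / mass π A) := by
  induction t with
  | zero =>
    intro y
    have := (hP.pi_pos x).ne'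
    rcases eq_or_ne y x with rfl | h
    · simp [setLaw, mass, this]
    · simp [setLaw, h, one_apply_ne h.symm]
  | succ t ih =>
    intro y
    have hy := (hP.pi_pos y).ne'
    have h1 : ∑ B, setLaw P π x (t + 1) B * ((if y ∈ B then π y else 0) / mass π B) =
        ∑ A, setLaw P π x t A *
          ((∑ B, levelProb P π A B * (if y ∈ B then 1 else 0)) * π y / mass π A) := by
      simp only [setLaw, Finset.sum_mul, Finset.sum_div, Finset.mul_sum]
      rw [Finset.sum_comm]
      refine Finset.sum_congr rfl fun A _ => Finset.sum_congr rfl fun B _ => ?_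
      split_ifs with h
      · have := (hP.mass_pos ⟨y, h⟩).ne'
        field_simp
      · simp
    rw [h1, pow_succ, mul_apply]
    simp only [ih, hP.sum_levelProb_mem, Finset.sum_mul, div_mul_cancel₀ _ hy]
    rw [Finset.sum_comm]
    refine Finset.sum_congr rfl fun A _ => ?_
    simp only [mul_assoc, ← Finset.mul_sum, div_mul_eq_mul_div, ← Finset.sum_div]
    simp [flow]

variable {R : Set ℝ} {g F G : ℝ → ℝ} {b c κ : ℝ}

theorem setMean_mem (hP : IsMarkovChain P π) (hR : Convex ℝ R)
    (hG : ∀ A : Finset V, A.Nonempty → G (mass π A) ∈ R) (x : V) (t : ℕ) :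
    setMean P π x G t ∈ R := by
  have hs : setMean P π x G t =
      ∑ A ∈ Finset.univ.filter (fun A : Finset V => A.Nonempty),
        setLaw P π x t A • G (mass π A) := by
    rw [Finset.sum_filter]
    refine Finset.sum_congr rfl fun A _ => ?_
    split_ifs with h
    · rfl
    · rw [Finset.not_nonempty_iff_eq_empty.1 h, setLaw_empty, zero_mul]
  rw [hs]
  refine hR.sum_mem (fun A _ => hP.setLaw_nonneg x t A) ?_ fun A hA => hG A (by simpa using hA)
  rw [← hP.sum_setLaw x t, Finset.sum_filter]
  refine Finset.sum_congr rfl fun A _ => ?_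
  split_ifs with h
  · rfl
  · rw [Finset.not_nonempty_iff_eq_empty.1 h, setLaw_empty]

/-- Averages the decay using an affine minorant `α + βy` of `g`. The condition `α ≤ 0` accounts for
the absorbed set `V`, where `G = 0` and nothing decays. -/
theorem setMean_succ_le (hP : IsMarkovChain P π) (hG1 : G 1 = 0)
    (hstep : ∀ A : Finset V, A.Nonempty → A ≠ Finset.univ →
      ∑ B, levelProb P π A B * (mass π B * G (mass π B)) ≤
        mass π A * (G (mass π A) - κ * g (G (mass π A)))) (hκ : 0 ≤ κ) {α β : ℝ}
    (hαβ : ∀ A : Finset V, A.Nonempty → A ≠ Finset.univ →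
      α + β * G (mass π A) ≤ g (G (mass π A))) (hα : α ≤ 0) (x : V) (t : ℕ) :
    setMean P π x G (t + 1) ≤
      setMean P π x G t - κ * (α + β * setMean P π x G t) := by
  have h1 : setMean P π x G t - κ * (α + β * setMean P π x G t) =
      ∑ A, setLaw P π x t A * (G (mass π A) - κ * (α + β * G (mass π A))) := by
    have : ∀ A, setLaw P π x t A * (G (mass π A) - κ * (α + β * G (mass π A))) =
      (1 - κ * β) * (setLaw P π x t A * G (mass π A)) - κ * α * setLaw P π x t A :=
      fun A => by ring
    simp only [this, Finset.sum_sub_distrib, ← Finset.mul_sum, hP.sum_setLaw, ← setMean.eq_def]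
    ring
  rw [h1, setMean_succ]
  refine Finset.sum_le_sum fun A _ => ?_
  rcases A.eq_empty_or_nonempty with rfl | hA
  · simp [setLaw_empty]
  refine mul_le_mul_of_nonneg_left ?_ (hP.setLaw_nonneg x t A)
  rw [div_le_iff₀ (hP.mass_pos hA)]
  by_cases hU : A = Finset.univ
  · subst hU
    have h0 : ∑ B, levelProb P π Finset.univ B * (mass π B * G (mass π B)) = 0 := by
      refine Finset.sum_eq_zero fun B _ => ?_
      by_cases hB : B = Finset.univ
      · simp [hB, hP.mass_univ, hG1]
      · rw [hP.levelProb_univ hB, zero_mul]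
    rw [h0, hP.mass_univ, hG1]
    nlinarith
  · refine (hstep A hA hU).trans ?_
    rw [mul_comm]
    refine mul_le_mul_of_nonneg_right ?_ (hP.mass_nonneg A)
    have := mul_le_mul_of_nonneg_left (hαβ A hA hU) hκ
    linarith

theorem setMean_succ_le_low (hP : IsMarkovChain P π) (hr : IsRate R g F b c) (hG1 : G 1 = 0)
    (hG : ∀ A : Finset V, A.Nonempty → G (mass π A) ∈ R)
    (hG0 : ∀ A : Finset V, A.Nonempty → A ≠ Finset.univ → 0 < G (mass π A))
    (hstep : ∀ A : Finset V, A.Nonempty → A ≠ Finset.univ →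
      ∑ B, levelProb P π A B * (mass π B * G (mass π B)) ≤
        mass π A * (G (mass π A) - κ * g (G (mass π A)))) (hκ : 0 ≤ κ) (x : V) (t : ℕ) :
    setMean P π x G (t + 1) ≤ setMean P π x G t - κ * (c * setMean P π x G t) := by
  have := hP.setMean_succ_le hG1 hstep hκ (α := 0) (β := c) (fun A hA hU => by
    rw [zero_add]; exact hr.low _ (hG A hA) (hG0 A hA hU)) le_rfl x t
  simpa using this

theorem setMean_succ_le_high (hP : IsMarkovChain P π) (hr : IsRate R g F b c) (hG1 : G 1 = 0)
    (hG : ∀ A : Finset V, A.Nonempty → G (mass π A) ∈ R)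
    (hG0 : ∀ A : Finset V, A.Nonempty → A ≠ Finset.univ → 0 < G (mass π A))
    (hstep : ∀ A : Finset V, A.Nonempty → A ≠ Finset.univ →
      ∑ B, levelProb P π A B * (mass π B * G (mass π B)) ≤
        mass π A * (G (mass π A) - κ * g (G (mass π A)))) (hκ : 0 ≤ κ) (x : V) (t : ℕ)
    (hb : b ≤ setMean P π x G t) :
    setMean P π x G (t + 1) ≤ setMean P π x G t - κ * g (setMean P π x G t) := by
  -- Jensen through the tangent at the current mean; beyond `b` its intercept at `0` is nonpositive,
  -- as absorption at `V` requires.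
  obtain ⟨s, hs, hs'⟩ := hr.tangent _ (hP.setMean_mem hr.convex hG x t) hb
  have := hP.setMean_succ_le hG1 hstep hκ
    (α := g (setMean P π x G t) - s * setMean P π x G t) (β := s) (fun A hA hU => by
      linarith [hs' _ (hG A hA) (hG0 A hA hU)]) (by linarith) x t
  simpa using this

end IsMarkovChain

end Chain

/-! ### Comparing distances with set means, and the one-step bounds. -/

section Distances

variable {V : Type*} [Fintype V] [DecidableEq V] {P : Matrix V V ℝ} {π : V → ℝ}

theorem mixingTime_le (d : (V → ℝ) → (V → ℝ) → ℝ) {ε : ℝ} {n : ℕ}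
    (h : ∀ x, d ((P ^ n) x) π ≤ ε) : mixingTime d P π ε ≤ n :=
  iInf_le (fun t : {t : ℕ // ∀ x, d ((P ^ t) x) π ≤ ε} => ((t : ℕ) : ℕ∞)) ⟨n, h⟩

theorem sum_pi_mul_indicator (A : Finset V) (φ : ℝ → ℝ) (h1 : ∑ x, π x = 1) :
    ∑ x, π x * φ (if x ∈ A then (mass π A)⁻¹ else 0) =
      mass π A * φ (mass π A)⁻¹ + (1 - mass π A) * φ 0 := by
  have : ∀ x, π x * φ (if x ∈ A then (mass π A)⁻¹ else 0) =
      (if x ∈ A then π x else 0) * φ (mass π A)⁻¹ + (π x - if x ∈ A then π x else 0) * φ 0 := by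
    intro x
    split_ifs <;> ring
  simp only [this, Finset.sum_add_distrib, ← Finset.sum_mul, Finset.sum_sub_distrib, h1]
  simp [mass]

namespace IsMarkovChain

theorem pow_div_eq (hP : IsMarkovChain P π) (x : V) (t : ℕ) (y : V) : (P ^ t) x y / π y =
    ∑ A, setLaw P π x t A * (if y ∈ A then (mass π A)⁻¹ else 0) := by
  have hy := (hP.pi_pos y).ne'
  rw [hP.pow_apply_eq, Finset.sum_div]
  refine Finset.sum_congr rfl fun A _ => ?_
  split_ifs
  · field_simp
  · simp

/-- Jensen's inequality along the evolving set representation of `P ^ t`. -/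
theorem sum_le_setMean (hP : IsMarkovChain P π) {φ G : ℝ → ℝ} (hφ : ConvexOn ℝ (Set.Ici 0) φ)
    (hG : ∀ a, 0 < a → a ≤ 1 → a * φ a⁻¹ + (1 - a) * φ 0 = G a) (x : V) (t : ℕ) :
    ∑ y, π y * φ ((P ^ t) x y / π y) ≤ setMean P π x G t := by
  have h1 : ∀ y, π y * φ ((P ^ t) x y / π y) ≤
      ∑ A, setLaw P π x t A * (π y * φ (if y ∈ A then (mass π A)⁻¹ else 0)) := by
    intro y
    have h := hφ.map_sum_le (t := Finset.univ) (w := setLaw P π x t)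
      (p := fun A => if y ∈ A then (mass π A)⁻¹ else 0) (fun A _ => hP.setLaw_nonneg x t A)
      (hP.sum_setLaw x t) (fun A _ => by
        show (0 : ℝ) ≤ _
        split_ifs
        · exact inv_nonneg.2 (hP.mass_nonneg A)
        · exact le_rfl)
    simp only [smul_eq_mul] at h
    rw [hP.pow_div_eq]
    simp only [mul_left_comm _ (π y), ← Finset.mul_sum]
    exact mul_le_mul_of_nonneg_left h (hP.pi_nonneg y)
  refine (Finset.sum_le_sum fun y _ => h1 y).trans ?_
  rw [Finset.sum_comm]
  simp only [← Finset.mul_sum]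
  refine Finset.sum_le_sum fun A _ => ?_
  rcases A.eq_empty_or_nonempty with rfl | hA
  · simp [setLaw_empty]
  · rw [sum_pi_mul_indicator A φ hP.pi_sum,
      hG _ (hP.mass_pos hA) (hP.mass_le_one A)]

theorem tvDist_le (hP : IsMarkovChain P π) (x : V) (t : ℕ) :
    tvDist ((P ^ t) x) π ≤ setMean P π x (fun a => 1 - a) t := by
  have hc : ConvexOn ℝ (Set.Ici 0) fun r : ℝ => 1 / 2 * |r - 1| := by
    have h1 : ConvexOn ℝ (Set.univ : Set ℝ) fun r : ℝ => |r - 1| := by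
      simpa [Real.dist_eq] using convexOn_univ_dist (1 : ℝ)
    simpa using (h1.subset (Set.subset_univ _) (convex_Ici 0)).smul (by norm_num : (0 : ℝ) ≤ 1 / 2)
  have h := hP.sum_le_setMean hc (G := fun a => 1 - a) (fun a h0 h1 => by
    have h2 : 1 ≤ a⁻¹ := (one_le_inv₀ h0).2 h1
    rw [abs_of_nonneg (by linarith), zero_sub, abs_neg, abs_one]
    field_simp
    ring) x t
  refine le_trans (le_of_eq ?_) h
  rw [tvDist, Finset.mul_sum]
  refine Finset.sum_congr rfl fun y _ => ?_
  have hy := hP.pi_pos y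
  have e : (P ^ t) x y - π y = π y * ((P ^ t) x y / π y - 1) := by field_simp
  rw [e, abs_mul, abs_of_pos hy]
  ring

theorem relEntropy_le (hP : IsMarkovChain P π) (x : V) (t : ℕ) :
    relEntropy ((P ^ t) x) π ≤ setMean P π x (fun a => -Real.log a) t := by
  have h := hP.sum_le_setMean Real.convexOn_mul_log (G := fun a => -Real.log a) (fun a h0 h1 => by
    rw [Real.log_inv, zero_mul]
    field_simp
    ring) x t
  refine le_trans (le_of_eq ?_) h
  simp only [relEntropy, mul_assoc]

/-- The triangle inequality is applied to the norm itself: Jensen for `(r-1)²` would only give the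
root of a mean, which is weaker than the mean of roots. The weights `√π` make the norm Euclidean. -/
theorem l2Dist_le (hP : IsMarkovChain P π) (x : V) (t : ℕ) :
    l2Dist ((P ^ t) x) π ≤ setMean P π x (fun a => Real.sqrt ((1 - a) / a)) t := by
  have hn : ∀ f : V → ℝ, Real.sqrt (∑ y, π y * (f y) ^ 2) =
      ‖WithLp.toLp 2 (fun y => Real.sqrt (π y) * f y)‖ := by
    intro f
    rw [EuclideanSpace.norm_eq]
    congr 1
    refine Finset.sum_congr rfl fun y _ => ?_
    simp [mul_pow, Real.sq_sqrt (hP.pi_nonneg y)]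
  have hv : WithLp.toLp 2 (fun y => Real.sqrt (π y) * ((P ^ t) x y / π y - 1)) =
      ∑ A, setLaw P π x t A • WithLp.toLp 2 (fun y => Real.sqrt (π y) *
        ((if y ∈ A then (mass π A)⁻¹ else 0) - 1)) := by
    ext y
    simp only [WithLp.ofLp_sum, WithLp.ofLp_smul, Finset.sum_apply, Pi.smul_apply, smul_eq_mul]
    simp only [mul_left_comm _ (Real.sqrt (π y)), ← Finset.mul_sum, mul_sub (setLaw _ _ _ _ _),
      Finset.sum_sub_distrib, mul_one, hP.sum_setLaw, hP.pow_div_eq]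
  rw [l2Dist, hn, hv, setMean]
  refine (norm_sum_le _ _).trans (Finset.sum_le_sum fun A _ => ?_)
  rw [norm_smul, Real.norm_of_nonneg (hP.setLaw_nonneg x t A), ← hn]
  rcases A.eq_empty_or_nonempty with rfl | hA
  · simp [setLaw_empty]
  have h0 := hP.mass_pos hA
  rw [sum_pi_mul_indicator A (fun r => (r - 1) ^ 2) hP.pi_sum]
  refine le_of_eq ?_
  congr 2
  field_simp
  ring

theorem step_tv (hP : IsMarkovChain P π) {A : Finset V} (hA : A.Nonempty)
    (hA' : A ≠ Finset.univ) :
    ∑ B, levelProb P π A B * (mass π B * (1 - mass π B)) ≤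
      mass π A * ((1 - mass π A) - modFlowMin P π * aMax P π * (4 / (1 - (1 - mass π A)))) := by
  have h := sum_mul_one_sub_le (levelProb_nonneg A) (sum_levelProb A)
    (hP.sum_levelProb_mul_mass A) (sum_levelProb_mul_abs A) fun B h => gapMin_le h
  have h2 := modFlowMin_mul_aMax_le (P := P) (π := π) hA hA'
  have h0 := (hP.mass_pos hA).ne'
  have e : mass π A * ((1 - mass π A) - modFlowMin P π * aMax P π * (4 / (1 - (1 - mass π A)))) =
      mass π A * (1 - mass π A) - 4 * (modFlowMin P π * aMax P π) := by
    rw [sub_sub_cancel]; field_simp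
  linarith

theorem step_relEntropy (hP : IsMarkovChain P π) {A : Finset V} (hA : A.Nonempty)
    (hA' : A ≠ Finset.univ) :
    ∑ B, levelProb P π A B * (mass π B * -Real.log (mass π B)) ≤
      mass π A * (-Real.log (mass π A) -
        modFlowMin P π * aMax P π * (2 * Real.exp (2 * -Real.log (mass π A)))) := by
  have h0 := hP.mass_pos hA
  have h := sum_mul_neg_log_le (levelProb_nonneg A) (sum_levelProb A)
    (hP.sum_levelProb_mul_mass A) (sum_levelProb_mul_abs A) (fun B h => gapMin_le h) h0
    hP.mass_nonneg
  have h2 := modFlowMin_mul_aMax_le (P := P) (π := π) hA hA'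
  have e0 : Real.exp (2 * -Real.log (mass π A)) = (mass π A ^ 2)⁻¹ := by
    rw [mul_neg, Real.exp_neg, mul_comm, Real.exp_mul, Real.exp_log h0]
    norm_cast
  have h3 : 2 * (modFlowMin P π * aMax P π) / mass π A ≤
      2 * (modFlow P π A * max (modFlow P π A) (gapMin π / 2)) / mass π A := by gcongr
  have e : mass π A * (-Real.log (mass π A) -
        modFlowMin P π * aMax P π * (2 * Real.exp (2 * -Real.log (mass π A)))) =
      mass π A * -Real.log (mass π A) - 2 * (modFlowMin P π * aMax P π) / mass π A := by
    rw [e0]; field_simp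
  linarith

theorem step_l2 (hP : IsMarkovChain P π) {A : Finset V} (hA : A.Nonempty)
    (hA' : A ≠ Finset.univ) :
    ∑ B, levelProb P π A B * (mass π B * Real.sqrt ((1 - mass π B) / mass π B)) ≤
      mass π A * (Real.sqrt ((1 - mass π A) / mass π A) - modFlowMin P π * aMax P π *
        ((1 + Real.sqrt ((1 - mass π A) / mass π A) ^ 2) ^ 4 /
          (2 * Real.sqrt ((1 - mass π A) / mass π A) ^ 3))) := by
  have h0 := hP.mass_pos hA
  have h1 := hP.mass_lt_one hA'
  have h := sum_sqrt_le (levelProb_nonneg A) (sum_levelProb A)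
    (hP.sum_levelProb_mul_mass A) (sum_levelProb_mul_abs A) (fun B h => gapMin_le h) h0 h1
    hP.mass_nonneg hP.mass_le_one
  have h2 := modFlowMin_mul_aMax_le (P := P) (π := π) hA hA'
  have es : ∀ a : ℝ, 0 ≤ a → a * Real.sqrt ((1 - a) / a) = Real.sqrt (a * (1 - a)) := by
    intro a ha
    rcases ha.eq_or_lt with rfl | ha
    · simp
    · have : a * (1 - a) = a ^ 2 * ((1 - a) / a) := by field_simp
      rw [this, Real.sqrt_mul (by positivity), Real.sqrt_sq ha.le]
  simp only [es _ (hP.mass_nonneg _)]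
  refine h.trans ?_
  rw [← es _ h0.le]
  generalize mass π A = a at *
  have hq : 0 < (1 - a) / a := div_pos (by linarith) h0
  have hy := Real.sqrt_pos.2 hq
  have hy2 := Real.sq_sqrt hq.le
  generalize Real.sqrt ((1 - a) / a) = y at *
  -- In terms of `y = √((1-a)/a)` the loss from `sum_sqrt_le` becomes the rate `(1+y²)⁴/(2y³)`.
  have ha : a = (1 + y ^ 2)⁻¹ := by rw [hy2]; field_simp; ring
  have ha' : a * (1 - a) = y ^ 2 * a ^ 2 := by rw [hy2]; field_simp
  rw [mul_assoc]
  refine mul_le_mul_of_nonneg_left ?_ h0.le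
  rw [ha', ha]
  have : 0 < 1 + y ^ 2 := by positivity
  generalize modFlow P π A * max (modFlow P π A) (gapMin π / 2) = m at *
  have h3 := mul_le_mul_of_nonneg_right h2
    (by positivity : 0 ≤ (1 + y ^ 2) ^ 4 / (2 * y ^ 3))
  have e : y * (1 - m / (2 * (y ^ 2 * (1 + y ^ 2)⁻¹ ^ 2) ^ 2)) =
      y - m * ((1 + y ^ 2) ^ 4 / (2 * y ^ 3)) := by
    field_simp
  linarith

/-! ### Geometric decay and the spectral bound. -/

theorem setMean_tv_le_pow (hP : IsMarkovChain P π) (x : V) {r : ℝ} (hr0 : 0 ≤ r)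
    (hr : 1 - 16 * modFlowMin P π * aMax P π ≤ r) (t : ℕ) :
    setMean P π x (fun a => 1 - a) t ≤ r ^ t := by
  have hm : ∀ A : Finset V, A.Nonempty → 1 - mass π A ∈ Set.Ico (0 : ℝ) 1 := fun A hA =>
    ⟨by linarith [hP.mass_le_one A], by linarith [hP.mass_pos hA]⟩
  induction t with
  | zero => rw [setMean_zero]; simpa using (hP.pi_nonneg x)
  | succ t ih =>
    have h := hP.setMean_succ_le_low isRate_tv (G := fun a => 1 - a) (sub_self 1) hm
      (fun A _ hA => sub_pos.2 (hP.mass_lt_one hA)) (fun A hA hA' => hP.step_tv hA hA')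
      (mul_nonneg modFlowMin_nonneg aMax_nonneg) x t
    have h0 := (hP.setMean_mem (convex_Ico 0 1) hm x t).1
    rw [pow_succ']
    have h1 := mul_le_mul_of_nonneg_right hr h0
    have h2 := mul_le_mul_of_nonneg_left ih hr0
    linarith

/-- One step from a singleton leaves a nonnegative mean, so the decay cannot exceed the whole. This
makes the ratio `1 - 16κ` nonnegative. -/
theorem modFlowMin_mul_aMax_le_one [Nontrivial V] (hP : IsMarkovChain P π) :
    16 * modFlowMin P π * aMax P π ≤ 1 := by
  obtain ⟨x, y, hxy⟩ := exists_pair_ne V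
  have hA : ({x} : Finset V).Nonempty := Finset.singleton_nonempty x
  have hA' : ({x} : Finset V) ≠ Finset.univ := fun h => hxy
    (Finset.mem_singleton.1 (h ▸ Finset.mem_univ y)).symm
  have h := hP.step_tv hA hA'
  have h1 : 0 ≤ ∑ B, levelProb P π {x} B * (mass π B * (1 - mass π B)) :=
    Finset.sum_nonneg fun B _ => mul_nonneg (levelProb_nonneg _ B)
      (mul_nonneg (hP.mass_nonneg B) (by linarith [hP.mass_le_one B]))
  have h0 := hP.mass_pos hA
  have h2 := nonneg_of_mul_nonneg_right (h1.trans h) h0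
  have h3 := hP.mass_lt_one hA'
  have h4 : 0 ≤ modFlowMin P π * aMax P π := mul_nonneg modFlowMin_nonneg aMax_nonneg
  have h5 := mul_le_mul_of_nonneg_left (isRate_tv.low (1 - mass π {x}) ⟨by linarith, by linarith⟩
    (by linarith)) h4
  have h6 : 16 * modFlowMin P π * aMax P π * (1 - mass π {x}) ≤ 1 * (1 - mass π {x}) := by
    linarith
  exact le_of_mul_le_mul_right h6 (by linarith)

theorem norm_eigenvalue_le [Nontrivial V] (hP : IsMarkovChain P π) {z : ℂ}
    (hz : Module.End.HasEigenvalue (Matrix.toLin' (P.map (fun a : ℝ => (a : ℂ)))) z)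
    (hz1 : z ≠ 1) : 16 * modFlowMin P π * aMax P π ≤ 1 - ‖z‖ := by
  obtain ⟨v, hv⟩ := hz.exists_hasEigenvector
  have hPv : ∀ x, ∑ y, (P x y : ℂ) * v y = z * v x := fun x => by
    have := congrFun hv.apply_eq_smul x
    simpa [Matrix.mulVec, dotProduct] using this
  have hpow : ∀ t : ℕ, ∀ x, ∑ y, ((P ^ t) x y : ℂ) * v y = z ^ t * v x := by
    intro t
    induction t with
    | zero => intro x; simp [one_apply, apply_ite ((↑) : ℝ → ℂ)]
    | succ t ih =>
      intro x
      simp only [pow_succ, mul_apply, Complex.ofReal_sum, Complex.ofReal_mul, Finset.sum_mul]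
      rw [Finset.sum_comm]
      simp only [mul_assoc, ← Finset.mul_sum, hPv]
      simp only [mul_left_comm _ z, ← Finset.mul_sum, ih]
  -- Pairing `Pv = zv` with the stationary `π` gives `π·v = z π·v`, so `π·v = 0`; thus `P^t v`
  -- depends only on `P^t - π`.
  have hπ : ∑ y, (π y : ℂ) * v y = 0 := by
    have h : ∑ y, (π y : ℂ) * v y = z * ∑ y, (π y : ℂ) * v y := by
      have h' : ∀ y, (π y : ℂ) = ∑ x, (π x : ℂ) * P x y := fun y => by
        exact_mod_cast congrArg ((↑) : ℝ → ℂ) (hP.sum_mul_eq y).symm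
      conv_lhs => rw [Finset.sum_congr rfl fun y _ => congrArg (· * v y) (h' y)]
      simp only [Finset.sum_mul]
      rw [Finset.sum_comm]
      simp only [mul_assoc, ← Finset.mul_sum, hPv]
      simp only [mul_left_comm _ z, ← Finset.mul_sum]
    have h2 : (1 - z) * ∑ y, (π y : ℂ) * v y = 0 := by linear_combination h
    exact (mul_eq_zero.1 h2).resolve_left (sub_ne_zero.2 hz1.symm)
  obtain ⟨x, hx⟩ := Function.ne_iff.1 hv.2
  have hx : 0 < ‖v x‖ := norm_pos_iff.2 hx
  obtain ⟨r, hr⟩ : ∃ r, r = 1 - 16 * modFlowMin P π * aMax P π := ⟨_, rfl⟩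
  have hr0 : 0 ≤ r := by rw [hr]; linarith [hP.modFlowMin_mul_aMax_le_one]
  have hbound : ∀ t : ℕ, ‖z‖ ^ t ≤ 2 * ‖v‖ / ‖v x‖ * r ^ t := by
    intro t
    have h1 : z ^ t * v x = ∑ y, (((P ^ t) x y - π y : ℝ) : ℂ) * v y := by
      simp only [Complex.ofReal_sub, sub_mul, Finset.sum_sub_distrib, hpow, hπ, sub_zero]
    have h2 : ‖z‖ ^ t * ‖v x‖ ≤ 2 * tvDist ((P ^ t) x) π * ‖v‖ := by
      rw [← norm_pow, ← norm_mul, h1, tvDist, ← mul_assoc, mul_one_div_cancel two_ne_zero, one_mul,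
        Finset.sum_mul]
      refine (norm_sum_le _ _).trans (Finset.sum_le_sum fun y _ => ?_)
      rw [norm_mul, Complex.norm_real, Real.norm_eq_abs]
      exact mul_le_mul_of_nonneg_left (norm_le_pi_norm v y) (abs_nonneg _)
    have h3 := (hP.tvDist_le x t).trans (hP.setMean_tv_le_pow x hr0 hr.ge t)
    rw [div_mul_eq_mul_div, le_div_iff₀ hx]
    refine h2.trans ?_
    have := mul_le_mul_of_nonneg_right h3 (norm_nonneg v)
    linarith
  -- Otherwise `(r/‖z‖)^t` would tend to `0`, while `hbound` keeps a fixed multiple of it at least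
  -- `1`.
  have hle : ‖z‖ ≤ r := by
    by_contra! hlt
    have hz0 : 0 < ‖z‖ := hr0.trans_lt hlt
    have hlim := (tendsto_pow_atTop_nhds_zero_of_lt_one (div_nonneg hr0 hz0.le)
      ((div_lt_one hz0).2 hlt)).const_mul (2 * ‖v‖ / ‖v x‖)
    rw [mul_zero] at hlim
    refine absurd (ge_of_tendsto' hlim (b := 1) fun t => ?_) (by norm_num)
    rw [div_pow, ← mul_div_assoc, le_div_iff₀ (pow_pos hz0 t), one_mul]
    exact hbound t
  linarith

theorem piStar_le (hP : IsMarkovChain P π) (x : V) : piStar π ≤ π x :=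
  ciInf_le ⟨0, by rintro _ ⟨y, rfl⟩; exact hP.pi_nonneg y⟩ x

theorem piStar_nonneg (hP : IsMarkovChain P π) : 0 ≤ piStar π := Real.iInf_nonneg hP.pi_nonneg

theorem piStar_le_half [Nontrivial V] (hP : IsMarkovChain P π) : piStar π ≤ 1 / 2 := by
  obtain ⟨x, y, hxy⟩ := exists_pair_ne V
  have h := hP.mass_le_one {x, y}
  rw [mass, Finset.sum_pair hxy] at h
  linarith [hP.piStar_le x, hP.piStar_le y]

theorem setMean_le (hP : IsMarkovChain P π) {R : Set ℝ} {g F G : ℝ → ℝ} {b c ε T : ℝ}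
    (hr : IsRate R g F b c) (hG1 : G 1 = 0)
    (hG : ∀ A : Finset V, A.Nonempty → G (mass π A) ∈ R)
    (hG0 : ∀ A : Finset V, A.Nonempty → A ≠ Finset.univ → 0 < G (mass π A))
    (hstep : ∀ A : Finset V, A.Nonempty → A ≠ Finset.univ →
      ∑ B, levelProb P π A B * (mass π B * G (mass π B)) ≤
        mass π A * (G (mass π A) - modFlowMin P π * aMax P π * g (G (mass π A))))
    (hε : 0 < ε) {M : ℝ} (hM0 : 0 ≤ M)
    (hM : ∀ x, b ≤ G (π x) → F b - F (G (π x)) ≤ M)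
    (hlow : ε ≤ b → M + Real.log (b / ε) / c ≤ modFlowMin P π * aMax P π * T)
    (hhigh : b < ε → ∀ x, ε < G (π x) → F ε - F (G (π x)) ≤ modFlowMin P π * aMax P π * T)
    (x : V) : setMean P π x G ⌈T⌉₊ ≤ ε := by
  have hκ : 0 ≤ modFlowMin P π * aMax P π := mul_nonneg modFlowMin_nonneg aMax_nonneg
  have hT := mul_le_mul_of_nonneg_left (Nat.le_ceil T) hκ
  have hI := hP.setMean_mem hr.convex hG x
  have h1 := hP.setMean_succ_le_low hr hG1 hG hG0 hstep hκ x
  have h2 := hP.setMean_succ_le_high hr hG1 hG hG0 hstep hκ x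
  rcases le_or_gt ε b with hb | hb
  · refine hr.le_of_low hκ hI h1 h2 hε hb hM0 ?_ ((hlow hb).trans hT)
    simpa only [setMean_zero] using hM x
  · refine hr.le_of_high hκ hI h1 h2 hb ?_
    simp only [setMean_zero]
    exact fun h => (hhigh hb x h).trans hT

end IsMarkovChain

end Distances

end EvolvingSets

/-! ### Assembling the constants. -/

open EvolvingSets

theorem corollary7 {V : Type*} [Fintype V] [DecidableEq V] [Nontrivial V]
    (P : Matrix V V ℝ) (π : V → ℝ) (hP : EvolvingSets.IsMarkovChain P π) :
    (∀ z : ℂ, Module.End.HasEigenvalue (Matrix.toLin' (P.map (fun a : ℝ => (a : ℂ)))) z → z ≠ 1 →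
      16 * EvolvingSets.modFlowMin P π * EvolvingSets.aMax P π ≤ 1 - ‖z‖) ∧
    (0 < EvolvingSets.modFlowMin P π → ∀ ε : ℝ, 0 < ε →
      EvolvingSets.mixingTime EvolvingSets.tvDist P π ε ≤
        (⌈if ε ≤ 1 / 2 then
            ((1 - 4 * EvolvingSets.piStar π ^ 2) / 2 + Real.log (1 / (2 * ε))) /
              (16 * EvolvingSets.modFlowMin P π * EvolvingSets.aMax P π)
          else
            ((1 - ε) ^ 2 - EvolvingSets.piStar π ^ 2) /
              (8 * EvolvingSets.modFlowMin P π * EvolvingSets.aMax P π)⌉₊ : ℕ∞) ∧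
      EvolvingSets.mixingTime EvolvingSets.relEntropy P π ε ≤
        (⌈if ε ≤ 1 / 2 then
            (1 - Real.exp 1 * EvolvingSets.piStar π ^ 2 + Real.log (1 / (2 * ε))) /
              (4 * Real.exp 1 * EvolvingSets.modFlowMin P π * EvolvingSets.aMax P π)
          else
            (Real.exp (-2 * ε) - EvolvingSets.piStar π ^ 2) /
              (4 * EvolvingSets.modFlowMin P π * EvolvingSets.aMax P π)⌉₊ : ℕ∞) ∧
      EvolvingSets.mixingTime EvolvingSets.l2Dist P π ε ≤
        (⌈if ε ≤ 1 then
            (2 / 3 + Real.log (1 / ε)) /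
              (8 * EvolvingSets.modFlowMin P π * EvolvingSets.aMax P π)
          else
            (1 + 3 * ε ^ 2) /
              (6 * EvolvingSets.modFlowMin P π * EvolvingSets.aMax P π *
                (1 + ε ^ 2) ^ 3)⌉₊ : ℕ∞)) := by
  refine ⟨fun z hz hz1 => hP.norm_eigenvalue_le hz hz1, fun hmin ε hε => ?_⟩
  have ha : 0 < aMax P π := hmin.trans_le (le_max_left _ _)
  have hps : ∀ x, piStar π ^ 2 ≤ π x ^ 2 := fun x =>
    pow_le_pow_left₀ hP.piStar_nonneg (hP.piStar_le x) 2
  have hps4 : piStar π ^ 2 ≤ 1 / 4 := by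
    have := pow_le_pow_left₀ hP.piStar_nonneg hP.piStar_le_half 2
    norm_num at this ⊢
    exact this
  have hlog : Real.log (1 / 2 / ε) = Real.log (1 / (2 * ε)) := by rw [div_div]
  have he := Real.exp_one_lt_three
  have he0 := Real.exp_pos 1
  have hm0 : ∀ A : Finset V, A.Nonempty → 0 < mass π A := fun A => hP.mass_pos
  have hm1 : ∀ A : Finset V, A ≠ Finset.univ → mass π A < 1 := fun A => hP.mass_lt_one
  refine ⟨mixingTime_le _ fun x => (hP.tvDist_le x _).trans ?_,
    mixingTime_le _ fun x => (hP.relEntropy_le x _).trans ?_,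
    mixingTime_le _ fun x => (hP.l2Dist_le x _).trans ?_⟩
  · refine hP.setMean_le isRate_tv (G := fun a => 1 - a) (sub_self 1)
      (fun A hA => ⟨by linarith [hP.mass_le_one A], by linarith [hm0 A hA]⟩)
      (fun A _ hA => sub_pos.2 (hm1 A hA)) (fun A hA hA' => hP.step_tv hA hA') hε
      -- `M` bounds `F(1/2) - F(1-π(x)) = 1/32 - π(x)²/8` over all starting states.
      (M := (1 - 4 * piStar π ^ 2) / 32) (by linarith) (fun x _ => ?_) (fun hb => ?_)
      (fun hb x hx => ?_) x
    · rw [sub_sub_cancel]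
      linarith [hps x]
    · rw [if_pos hb, hlog]
      refine le_of_eq ?_
      field_simp
      ring
    · rw [if_neg (not_le.2 hb)]
      have e : modFlowMin P π * aMax P π * (((1 - ε) ^ 2 - piStar π ^ 2) /
          (8 * modFlowMin P π * aMax P π)) = ((1 - ε) ^ 2 - piStar π ^ 2) / 8 := by
        field_simp
      rw [e, sub_sub_cancel]
      linarith [hps x]
  · have hexp : ∀ x, Real.exp (-2 * -Real.log (π x)) = π x ^ 2 := fun x => by
      rw [neg_mul_neg, mul_comm, Real.exp_mul, Real.exp_log (hP.pi_pos x)]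
      norm_cast
    have hexp' : Real.exp (-2 * (1 / 2)) = (Real.exp 1)⁻¹ := by
      rw [← Real.exp_neg]; norm_num
    refine hP.setMean_le isRate_relEntropy (G := fun a => -Real.log a) (by simp)
      (fun A hA => neg_nonneg.2 (Real.log_nonpos (hm0 A hA).le (hP.mass_le_one A)))
      (fun A hA hA' => neg_pos.2 (Real.log_neg (hm0 A hA) (hm1 A hA')))
      (fun A hA hA' => hP.step_relEntropy hA hA') hε
      -- Here `F(-log π(x)) = π(x)²/4`; that `M ≥ 0` follows from `π_*² ≤ 1/4` and `e < 3`.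
      (M := ((Real.exp 1)⁻¹ - piStar π ^ 2) / 4) ?_ (fun x _ => ?_) (fun hb => ?_)
      (fun hb x hx => ?_) x
    · have : (3 : ℝ)⁻¹ ≤ (Real.exp 1)⁻¹ := inv_anti₀ he0 he.le
      linarith
    · rw [hexp, hexp']
      linarith [hps x]
    · rw [if_pos hb, hlog]
      refine le_of_eq ?_
      field_simp
    · rw [if_neg (not_le.2 hb)]
      have e : modFlowMin P π * aMax P π * ((Real.exp (-2 * ε) - piStar π ^ 2) /
          (4 * modFlowMin P π * aMax P π)) = (Real.exp (-2 * ε) - piStar π ^ 2) / 4 := by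
        field_simp
      rw [e, hexp]
      linarith [hps x]
  · have hF : ∀ y : ℝ, 0 ≤ (1 + 3 * y ^ 2) / (6 * (1 + y ^ 2) ^ 3) := fun y => by positivity
    refine hP.setMean_le isRate_l2 (G := fun a => Real.sqrt ((1 - a) / a)) (by simp)
      (fun A _ => Real.sqrt_nonneg _)
      (fun A hA hA' => Real.sqrt_pos.2 (div_pos (sub_pos.2 (hm1 A hA')) (hm0 A hA)))
      (fun A hA hA' => hP.step_l2 hA hA') hε
      -- `F(1) = 1/12`; the nonnegative starting value of `F` is dropped, so no `π_*` term survives.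
      (M := 1 / 12) (by norm_num) (fun x _ => ?_) (fun hb => ?_) (fun hb x hx => ?_) x
    · refine (sub_le_self _ (hF _)).trans ?_
      norm_num
    · rw [if_pos hb]
      refine le_of_eq ?_
      field_simp
      ring
    · rw [if_neg (not_le.2 hb)]
      refine (sub_le_self _ (hF _)).trans (le_of_eq ?_)
      field_simp
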